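/- Let $k\ge 1$, let $q_1,\dots,q_k$ be distinct points of the unit sphere $S^2\subset\mathbb R^3$, and set $$M_k=\bigcup_{l=1}^k\big(S^2\cap q_l^{\perp}\big),\qquad Q_k=\{\pm q_1,\dots,\pm q_k\}.$$ Let $\lambda_n,\delta_n>0$ satisfy $\lambda_n\to0$, $\delta_n\to 0$ and $\lambda_n/\sqrt{\delta_n}\to 0$. Put $I=(0,1)$ and $N_n=\lfloor 1/\lambda_n\rfloor$, so that $\{0,\dots,N_n\}$ is the set of integers $i$ with $\lambda_n i\in[0,1]$. Let $C_n(I,M_k)$ be the set of spin configurations $u=(u^0,\dots,u^{N_n})$ with values in $M_k$ and $$(u^1,u^0)=(u^{N_n},u^{N_n-1}),$$ where $(\cdot,\cdot)$ is the scalar product. The energy of $u$ is $$H_n^{sl}(u)=\frac12\sum_{i=0}^{N_n-2}\lambda_n\,\big|u^{i+2}-2(1-\delta_n)u^{i+1}+u^i\big|^2 .$$ The chirality of $u$ is $z^i=\frac{u^i\times u^{i+1}}{\sqrt{2\delta_n}}$ for $0\le i\le N_n-1$, with $z^{N_n}:=z^{N_n-1}$. Let $T_n(u)\in L^1(I,\mathbb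 R^3)$ be its piecewise constant interpolation, equal to $z^i$ on $I\cap\lambda_n[i,i+1)$. For $z\in L^1(I,\mathbb R^3)$ set $$H_n^{sl,k}(z)=\inf\{H_n^{sl}(u):\ u\in C_n(I,M_k),\ T_n(u)=z\},\qquad \inf\emptyset=+\infty .$$ Then, with respect to the strong topology of $L^1(I,\mathbb R^3)$, the functionals $$\frac{H_n^{sl,k}}{\sqrt2\,\lambda_n\,\delta_n^{3/2}}$$ $\Gamma$-converge to the functional $$H^{sl,k}(z)=\begin{cases}\dfrac83\,\#S(z)&\text{if } z\in BV(I,Q_k),\\[1mm]+\infty&\text{otherwise.}\end{cases}$$ Here $BV(I,Q_k)$ is the set of functions of bounded variation on $I$ with values in $Q_k$ almost everywhere, and $S(z)\subset I$ is the jump set of $z$ (the set of points without approximate limit). In particular, the cost $8/3$ of a jump is the same for every pair of distinct chiralities in $Q_k$. -/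

import Mathlib

open MeasureTheory Filter Topology
open scoped ENNReal

noncomputable section

namespace HelicalChain

/-- Three-dimensional Euclidean space. -/
abbrev E3 : Type := EuclideanSpace ℝ (Fin 3)

/-- The vector product on Euclidean three-space. -/
def cross (a b : E3) : E3 := WithLp.toLp 2 (crossProduct a.ofLp b.ofLp)

/-- Lebesgue measure on the interval `I = (0,1)`. -/
def volI : Measure ℝ := volume.restrict (Set.Ioo 0 1)

/-- The space `L¹(I, ℝ³)` with its norm (strong) topology. -/
abbrev L1I : Type := Lp E3 1 volI

/-! ### The discrete spin chain

The lattice `ℤ_n(I)`, i.e. the set of integers `i` with `lam * i ∈ [0,1]`, is `{0, …, N}` with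
`N = ⌊1/lam⌋`. A spin configuration is stored as a function `u : ℕ → E3`, of which only the values
at the indices `0, …, N` matter. -/

/-- Index of the last lattice point: `N = ⌊1/lam⌋`. -/
def lastIdx (lam : ℝ) : ℕ := ⌊1 / lam⌋₊

/-- The spin configurations on the lattice with values in `M` such that the scalar products of the
first two spins and of the last two spins agree. -/
def Configs (lam : ℝ) (M : Set E3) : Set (ℕ → E3) :=
  {u | (∀ i ≤ lastIdx lam, u i ∈ M) ∧
    inner ℝ (u 1) (u 0) = inner ℝ (u (lastIdx lam)) (u (lastIdx lam - 1))}

/-- The renormalized energy of a configuration. The sum runs over the `i` for which `i` and `i + 2`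
are lattice indices, that is `0 ≤ i < N - 1`. -/
def energy (lam delta : ℝ) (u : ℕ → E3) : ℝ :=
  (1 / 2) * ∑ i ∈ Finset.range (lastIdx lam - 1),
    lam * ‖u (i + 2) - (2 * (1 - delta)) • u (i + 1) + u i‖ ^ 2

/-- The chirality `zⁱ = (uⁱ × uⁱ⁺¹) / √(2 delta)`, for `0 ≤ i ≤ N - 1`. At the last lattice
index `N`, where `uⁱ⁺¹` is not available, the value `zᴺ⁻¹` is repeated. -/
def chirality (lam delta : ℝ) (u : ℕ → E3) (i : ℕ) : E3 :=
  (Real.sqrt (2 * delta))⁻¹ •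
    cross (u (min i (lastIdx lam - 1))) (u (min i (lastIdx lam - 1) + 1))

/-- The piecewise constant interpolation of the chirality: it equals `zⁱ` on
`[lam * i, lam * (i + 1))`. -/
def chiralityFun (lam delta : ℝ) (u : ℕ → E3) (x : ℝ) : E3 :=
  chirality lam delta u ⌊x / lam⌋₊

/-- The energy as a functional of the chirality, for spins constrained to `M`: the infimum of the
energies of the `M`-valued configurations with chirality `z`, and `+∞` if there are none. -/
def chiralEnergy (lam delta : ℝ) (M : Set E3) (z : L1I) : ℝ≥0∞ :=
  ⨅ u ∈ {u | u ∈ Configs lam M ∧ (z : ℝ → E3) =ᵐ[volI] chiralityFun lam delta u},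
    ENNReal.ofReal (energy lam delta u)

/-! ### The constraint -/

/-- The set `M_k`: the union of the great circles `S² ∩ q_l^⊥`. -/
def circles {k : ℕ} (q : Fin k → E3) : Set E3 :=
  ⋃ l, {x | ‖x‖ = 1 ∧ inner ℝ (q l) x = 0}

/-- The set `Q_k = {± q_1, …, ± q_k}`. -/
def wells {k : ℕ} (q : Fin k → E3) : Set E3 :=
  {x | ∃ l, x = q l ∨ x = -q l}

/-! ### Functions of bounded variation on `I` and the limit functional -/

/-- The total variation in `I` of the distributional derivative: the supremum of `∫_I ⟨z, φ'⟩`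
over the `C¹` test fields `φ` with compact support in `I` and `|φ| ≤ 1`. -/
def totalVariation (z : ℝ → E3) : ℝ≥0∞ :=
  ⨆ φ ∈ {φ : ℝ → E3 | ContDiff ℝ 1 φ ∧ HasCompactSupport φ ∧
      tsupport φ ⊆ Set.Ioo 0 1 ∧ ∀ x, ‖φ x‖ ≤ 1},
    ENNReal.ofReal (∫ x, inner ℝ (z x) (deriv φ x) ∂volI)

/-- The class `BV(I, Q)` of the functions of bounded variation with values in `Q`. -/
def BVI (Q : Set E3) : Set L1I :=
  {z | totalVariation z < ∞ ∧ ∀ᵐ x ∂volI, z x ∈ Q}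

/-- The approximate discontinuity set `S(z)`: the points of `I` at which `z` has no approximate
limit. For functions of bounded variation of one variable this is the jump set. -/
def jumpSet (z : ℝ → E3) : Set ℝ :=
  {x ∈ Set.Ioo (0 : ℝ) 1 | ¬ ∃ a : E3,
    Tendsto (fun r : ℝ => ⨍ y in Metric.ball x r, ‖z y - a‖) (𝓝[>] 0) (𝓝 0)}

open Classical in
/-- The limit functional: `8/3` times the number of jumps on `BV(I, Q)`, and `+∞` elsewhere. -/
def limitEnergy (Q : Set E3) (z : L1I) : ℝ≥0∞ :=
  if z ∈ BVI Q then ENNReal.ofReal (8 / 3) * ((jumpSet z).encard : ℝ≥0∞) else ∞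

/-- `Γ`-convergence of a sequence of functionals on a metric space: the lower bound along every
convergent sequence, and a recovery sequence for every point. -/
def GammaConverges {X : Type*} [PseudoMetricSpace X] (F : ℕ → X → ℝ≥0∞) (G : X → ℝ≥0∞) : Prop :=
  (∀ (x : X) (xs : ℕ → X), Tendsto xs atTop (𝓝 x) →
      G x ≤ liminf (fun n => F n (xs n)) atTop) ∧
    ∀ x : X, ∃ xs : ℕ → X, Tendsto xs atTop (𝓝 x) ∧
      limsup (fun n => F n (xs n)) atTop ≤ G x

end HelicalChain

end

namespace HelicalChain

/-! Put s = √(2δ). The normalised energy is s⁻³ ∑ ‖defect‖², and splitting each defect along and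
across its middle spin (`norm_defect_sq`) turns this into ∑ (‖Δz‖²/s + s (1 - averaged squared
speed)²). At bounded energy the squared speed agrees with |z|² up to O(s) (`speedSq_le`), so this is
a discrete Modica–Mortola energy of step s for the chirality z.

Lower bound. Among k + 1 consecutive spins two lie on the same great circle, and at bounded energy
the chirality varies slowly, so z stays uniformly close to the lines ℝ q_l (`exists_axis`). To move
between two distinct points of Q_k it must therefore pass near the origin, whichever points they
are. By Young's inequality the descent of |z| from 1 to 0 costs 2 ∫₀¹ (1 - r²) dr = 4/3, and so does
the ascent: together 8/3 (`transition_energy_ge`). Fatou's lemma and λ/s → 0 give |z| = 1 almost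
everywhere in the limit (`norm_eq_one_ae`); transitions at different jumps use disjoint sets of
sites, so their costs add up (`card_mul_le`). A function with values in a finite set and finitely
many approximate discontinuities is piecewise constant (`exists_ae_eq_const`), hence of bounded
variation.

Upper bound. Any two great circles meet. The spin slows to a stop at a common point of the old and
new circles and leaves along the new one. The optimal speed is |tanh|; rescaled so as to reach 1 at
a finite time T it costs `transitionCost T`, which tends to 8/3. Sampling with angle α, where 2
sin(α/2) = s, costs nothing on uniform rotations and at most s³ times the continuum bound on a
transition (`sum_norm_curveDefect_sq_le`). Transitions are spliced along arcs of uniform rotation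
(`exists_transitionChain`). The interval I corresponds to a total angle α/λ → ∞, which leaves room
for T → ∞. -/

/-! ### Coordinates and identities for the vector product. -/

theorem inner_eq_coords (a b : E3) : inner ℝ a b = a 0 * b 0 + a 1 * b 1 + a 2 * b 2 := by
  simp [PiLp.inner_apply, Fin.sum_univ_three, mul_comm]

theorem norm_sq_eq_coords (a : E3) : ‖a‖ ^ 2 = a 0 ^ 2 + a 1 ^ 2 + a 2 ^ 2 := by
  rw [← real_inner_self_eq_norm_sq, inner_eq_coords]; ring

@[simp] theorem cross_zero_coord (a b : E3) : cross a b 0 = a 1 * b 2 - a 2 * b 1 := by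
  simp [cross, cross_apply]

@[simp] theorem cross_one_coord (a b : E3) : cross a b 1 = a 2 * b 0 - a 0 * b 2 := by
  simp [cross, cross_apply]

@[simp] theorem cross_two_coord (a b : E3) : cross a b 2 = a 0 * b 1 - a 1 * b 0 := by
  simp [cross, cross_apply]

theorem ext_coords {a b : E3} (h0 : a 0 = b 0) (h1 : a 1 = b 1) (h2 : a 2 = b 2) : a = b := by
  ext i; fin_cases i <;> assumption

theorem cross_add_right (a b c : E3) : cross a (b + c) = cross a b + cross a c := by
  apply ext_coords <;> simp <;> ring

theorem cross_sub_right (a b c : E3) : cross a (b - c) = cross a b - cross a c := by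
  apply ext_coords <;> simp <;> ring

theorem cross_smul_right (t : ℝ) (a b : E3) : cross a (t • b) = t • cross a b := by
  apply ext_coords <;> simp <;> ring

theorem cross_anticomm' (a b : E3) : cross b a = -cross a b := by
  apply ext_coords <;> simp <;> ring

theorem cross_self' (a : E3) : cross a a = 0 := by
  apply ext_coords <;> simp <;> ring

theorem inner_cross_left_self (a b : E3) : inner ℝ a (cross a b) = 0 := by
  rw [inner_eq_coords]; simp; ring

theorem inner_cross_right_self (a b : E3) : inner ℝ b (cross a b) = 0 := by
  rw [inner_eq_coords]; simp; ring

theorem norm_cross_sq (a b : E3) :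
    ‖cross a b‖ ^ 2 = ‖a‖ ^ 2 * ‖b‖ ^ 2 - (inner ℝ a b) ^ 2 := by
  rw [norm_sq_eq_coords, norm_sq_eq_coords, norm_sq_eq_coords, inner_eq_coords]; simp; ring

theorem norm_cross_le (a b : E3) : ‖cross a b‖ ≤ ‖a‖ * ‖b‖ := by
  refine (sq_le_sq₀ (norm_nonneg _) (by positivity)).mp ?_
  rw [norm_cross_sq, mul_pow]
  nlinarith [sq_nonneg (inner ℝ a b : ℝ)]

/-- Vectors orthogonal to the unit vector `q` have a vector product parallel to `q`. -/
theorem cross_eq_smul_of_orthogonal {q a b : E3} (hq : ‖q‖ = 1) (ha : inner ℝ q a = 0)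
    (hb : inner ℝ q b = 0) : cross a b = (inner ℝ q (cross a b) : ℝ) • q := by
  have h1 : q 0 ^ 2 + q 1 ^ 2 + q 2 ^ 2 = 1 := by rw [← norm_sq_eq_coords, hq]; norm_num
  rw [inner_eq_coords] at ha hb
  rw [inner_eq_coords]
  apply ext_coords
  · simp
    linear_combination (-(a 1 * b 2 - a 2 * b 1)) * h1 + (q 1 * b 2 - q 2 * b 1) * ha +
      (q 2 * a 1 - q 1 * a 2) * hb
  · simp
    linear_combination (-(a 2 * b 0 - a 0 * b 2)) * h1 + (q 2 * b 0 - q 0 * b 2) * ha +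
      (q 0 * a 2 - q 2 * a 0) * hb
  · simp
    linear_combination (-(a 0 * b 1 - a 1 * b 0)) * h1 + (q 0 * b 1 - q 1 * b 0) * ha +
      (q 1 * a 0 - q 0 * a 1) * hb

/-- For a unit vector `a`, the component of `b` orthogonal to `a` is `-a × (a × b)`. -/
theorem eq_inner_smul_sub_cross_cross {a : E3} (ha : ‖a‖ = 1) (b : E3) :
    b = (inner ℝ a b : ℝ) • a - cross a (cross a b) := by
  have h1 : a 0 ^ 2 + a 1 ^ 2 + a 2 ^ 2 = 1 := by rw [← norm_sq_eq_coords, ha]; norm_num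
  rw [inner_eq_coords]
  apply ext_coords
  · simp; linear_combination (-b 0) * h1
  · simp; linear_combination (-b 1) * h1
  · simp; linear_combination (-b 2) * h1

/-- The span of two vectors is a proper subspace of three-space. For two axes this yields a common
point of their great circles; for a repeated axis it yields a starting point. -/
theorem exists_unit_orthogonal (a b : E3) :
    ∃ v : E3, ‖v‖ = 1 ∧ inner ℝ a v = 0 ∧ inner ℝ b v = 0 := by
  have hfin : Module.finrank ℝ (Submodule.span ℝ ({a, b} : Set E3)) ≤ 2 :=
    (finrank_span_le_card ({a, b} : Set E3)).trans (by
      rw [Set.toFinset_insert, Set.toFinset_singleton]; exact Finset.card_le_two)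
  have hne : (Submodule.span ℝ ({a, b} : Set E3))ᗮ ≠ ⊥ := by
    intro h
    have h2 := Submodule.finrank_add_finrank_orthogonal (Submodule.span ℝ ({a, b} : Set E3))
    rw [h, finrank_bot, finrank_euclideanSpace_fin] at h2
    omega
  obtain ⟨w, hw, hw0⟩ := Submodule.exists_mem_ne_zero_of_ne_bot hne
  rw [Submodule.mem_orthogonal] at hw
  have ha := hw a (Submodule.subset_span (by simp))
  have hb := hw b (Submodule.subset_span (by simp))
  refine ⟨‖w‖⁻¹ • w, ?_, ?_, ?_⟩
  · rw [norm_smul, norm_inv, norm_norm, inv_mul_cancel₀ (norm_ne_zero_iff.mpr hw0)]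
  · rw [inner_smul_right, ha, mul_zero]
  · rw [inner_smul_right, hb, mul_zero]

/-! ### The energy density of a chain of unit vectors -/

/-- The second difference `uⁱ⁺² - (2 - s²) uⁱ⁺¹ + uⁱ`. -/
noncomputable def defect (s : ℝ) (u : ℕ → E3) (i : ℕ) : E3 :=
  u (i + 2) - (2 - s ^ 2) • u (i + 1) + u i

/-- The chirality of the bond `(i, i + 1)` in units of `s`. -/
noncomputable def bondChirality (s : ℝ) (u : ℕ → E3) (i : ℕ) : E3 := s⁻¹ • cross (u i) (u (i + 1))

/-- The squared discrete speed of the bond `(i, i + 1)`. -/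
noncomputable def speedSq (s : ℝ) (u : ℕ → E3) (i : ℕ) : ℝ := ‖u (i + 1) - u i‖ ^ 2 / s ^ 2

theorem inner_eq_one_sub {a b : E3} (ha : ‖a‖ = 1) (hb : ‖b‖ = 1) :
    (inner ℝ a b : ℝ) = 1 - ‖b - a‖ ^ 2 / 2 := by
  rw [norm_sub_sq_real, ha, hb, real_inner_comm]; ring

/-- Decompose the defect with respect to the unit vector `u (i + 1)`. The vector product with it
kills the middle term and leaves s times the increment of the chirality; the scalar product sees
only the speeds. Lagrange's identity adds the two squares. -/
theorem norm_defect_sq {s : ℝ} (hs : 0 < s) {u : ℕ → E3} {i : ℕ} (h0 : ‖u i‖ = 1)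
    (h1 : ‖u (i + 1)‖ = 1) (h2 : ‖u (i + 2)‖ = 1) :
    ‖defect s u i‖ ^ 2 = s ^ 2 * ‖bondChirality s u (i + 1) - bondChirality s u i‖ ^ 2 +
      s ^ 4 * (1 - (speedSq s u i + speedSq s u (i + 1)) / 2) ^ 2 := by
  have hc : cross (u (i + 1)) (defect s u i) =
      s • (bondChirality s u (i + 1) - bondChirality s u i) := by
    rw [defect, cross_add_right, cross_sub_right, cross_smul_right, cross_self', smul_zero,
      sub_zero, bondChirality, bondChirality, ← smul_sub, smul_smul, mul_inv_cancel₀ hs.ne',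
      one_smul, cross_anticomm' (u i) (u (i + 1)), sub_eq_add_neg]
  have hi : (inner ℝ (u (i + 1)) (defect s u i) : ℝ) =
      s ^ 2 * (1 - (speedSq s u i + speedSq s u (i + 1)) / 2) := by
    rw [defect, inner_add_right, inner_sub_right, inner_smul_right, real_inner_self_eq_norm_sq,
      inner_eq_one_sub h1 h2, inner_eq_one_sub h1 h0, h1, speedSq, speedSq,
      norm_sub_rev (u i) (u (i + 1))]
    field_simp
    ring
  have h := norm_cross_sq (u (i + 1)) (defect s u i)
  rw [hc, hi, h1, norm_smul, Real.norm_of_nonneg hs.le] at h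
  linear_combination -h

/-- The chirality measures the sine of the bond angle, the speed its chord. The correction is not
small a priori: antipodal neighbours have zero chirality and maximal speed. The energy bound rules
this out in `speedSq_le`. -/
theorem norm_bondChirality_sq {s : ℝ} (hs : 0 < s) {u : ℕ → E3} {i : ℕ} (h0 : ‖u i‖ = 1)
    (h1 : ‖u (i + 1)‖ = 1) :
    ‖bondChirality s u i‖ ^ 2 = speedSq s u i - s ^ 2 * speedSq s u i ^ 2 / 4 := by
  rw [bondChirality, norm_smul, mul_pow, norm_cross_sq, inner_eq_one_sub h0 h1, h0, h1, speedSq,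
    Real.norm_of_nonneg (inv_nonneg.mpr hs.le)]
  field_simp
  ring

theorem speedSq_nonneg (s : ℝ) (u : ℕ → E3) (i : ℕ) : 0 ≤ speedSq s u i := by
  unfold speedSq; positivity

/-- A chain of unit vectors with sites `0, …, N` and renormalized energy at most `K²`. -/
structure BoundedChain (s K : ℝ) (N : ℕ) (u : ℕ → E3) : Prop where
  pos : 0 < s
  le_one : s ≤ 1
  nonneg : 0 ≤ K
  unit : ∀ i ≤ N, ‖u i‖ = 1
  energy_le : ∑ i ∈ Finset.range (N - 1), ‖defect s u i‖ ^ 2 ≤ K ^ 2 * s ^ 3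

namespace BoundedChain

variable {s K : ℝ} {N : ℕ} {u : ℕ → E3}

theorem norm_defect_sq_le (h : BoundedChain s K N u) {i : ℕ} (hi : i + 2 ≤ N) :
    ‖defect s u i‖ ^ 2 ≤ K ^ 2 * s ^ 3 :=
  (Finset.single_le_sum (f := fun i => ‖defect s u i‖ ^ 2) (fun _ _ => by positivity)
    (Finset.mem_range.mpr (by omega))).trans h.energy_le

theorem norm_defect_sq_eq (h : BoundedChain s K N u) {i : ℕ} (hi : i + 2 ≤ N) :
    ‖defect s u i‖ ^ 2 = s ^ 2 * ‖bondChirality s u (i + 1) - bondChirality s u i‖ ^ 2 +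
      s ^ 4 * (1 - (speedSq s u i + speedSq s u (i + 1)) / 2) ^ 2 :=
  norm_defect_sq h.pos (h.unit _ (by omega)) (h.unit _ (by omega)) (h.unit _ (by omega))

theorem norm_defect_le (h : BoundedChain s K N u) {i : ℕ} (hi : i + 2 ≤ N) :
    ‖defect s u i‖ ≤ K * √s * s := by
  have hs := h.pos
  have hK := h.nonneg
  refine (sq_le_sq₀ (norm_nonneg _) (by positivity)).mp ((h.norm_defect_sq_le hi).trans_eq ?_)
  rw [mul_pow, mul_pow, Real.sq_sqrt hs.le]; ring

theorem norm_bondChirality_succ_sub_le (h : BoundedChain s K N u) {i : ℕ} (hi : i + 2 ≤ N) :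
    ‖bondChirality s u (i + 1) - bondChirality s u i‖ ≤ K * √s := by
  have hs := h.pos
  have hK := h.nonneg
  refine (sq_le_sq₀ (norm_nonneg _) (by positivity)).mp ?_
  have h1 := h.norm_defect_sq_le hi
  rw [h.norm_defect_sq_eq hi] at h1
  rw [mul_pow, Real.sq_sqrt hs.le]
  have h2 : 0 ≤ s ^ 4 * (1 - (speedSq s u i + speedSq s u (i + 1)) / 2) ^ 2 := by positivity
  have h3 : s ^ 2 * ‖bondChirality s u (i + 1) - bondChirality s u i‖ ^ 2 ≤
      s ^ 2 * (K ^ 2 * s) := by linarith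
  exact le_of_mul_le_mul_left h3 (by positivity)

theorem norm_bondChirality_add_sub_le (h : BoundedChain s K N u) {i : ℕ} :
    ∀ {j : ℕ}, i + j + 1 ≤ N →
      ‖bondChirality s u (i + j) - bondChirality s u i‖ ≤ j * (K * √s)
  | 0, _ => by simp
  | j + 1, hj => by
    have h1 := h.norm_bondChirality_add_sub_le (i := i) (j := j) (by omega)
    have h2 := h.norm_bondChirality_succ_sub_le (i := i + j) (by omega)
    have h3 := norm_sub_le_norm_sub_add_norm_sub (bondChirality s u (i + (j + 1)))
      (bondChirality s u (i + j)) (bondChirality s u i)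
    rw [← add_assoc] at h3 ⊢
    push_cast
    linarith

theorem abs_one_sub_speedSq_le (h : BoundedChain s K N u) {i : ℕ} (hi : i + 2 ≤ N) :
    |1 - (speedSq s u i + speedSq s u (i + 1)) / 2| * √s ≤ K := by
  have hs := h.pos
  have hK := h.nonneg
  refine (sq_le_sq₀ (by positivity) hK).mp ?_
  have h1 := h.norm_defect_sq_le hi
  rw [h.norm_defect_sq_eq hi] at h1
  rw [mul_pow, Real.sq_sqrt hs.le, sq_abs]
  have h2 : 0 ≤ s ^ 2 * ‖bondChirality s u (i + 1) - bondChirality s u i‖ ^ 2 := by positivity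
  have h3 : s ^ 3 * ((1 - (speedSq s u i + speedSq s u (i + 1)) / 2) ^ 2 * s) ≤ s ^ 3 * K ^ 2 := by
    linarith
  exact le_of_mul_le_mul_left h3 (by positivity)

/-- Since `p'` is nonnegative, a bound on the average bounds `p` by 2 (1 + K)/√s, and its square
loses only one of the two factors s. -/
theorem speedSq_mul_sq_le_of_avg (hs : 0 < s) (hs1 : s ≤ 1) {p p' : ℝ}
    (hp : 0 ≤ p) (hp' : 0 ≤ p')
    (h : |1 - (p + p') / 2| * √s ≤ K) :
    s ^ 2 * p ^ 2 / 4 ≤ s * (1 + K) ^ 2 := by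
  have ht : 0 < √s := Real.sqrt_pos.mpr hs
  have ht1 : √s ≤ 1 := Real.sqrt_le_one.mpr hs1
  have hts : √s ^ 2 = s := Real.sq_sqrt hs.le
  set t := √s
  have h1 : ((p + p') / 2 - 1) * t ≤ K :=
    le_trans (mul_le_mul_of_nonneg_right (by rw [abs_sub_comm]; exact le_abs_self _) ht.le) h
  have h2 : p * t / 2 ≤ 1 + K := by nlinarith [mul_nonneg hp' ht.le]
  rw [← hts]
  have h3 : (p * t / 2) ^ 2 ≤ (1 + K) ^ 2 := pow_le_pow_left₀ (by positivity) h2 2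
  nlinarith [mul_le_mul_of_nonneg_left h3 (sq_nonneg t)]

theorem speedSq_le (h : BoundedChain s K N u) {i : ℕ} (hN : 2 ≤ N) (hi : i + 1 ≤ N) :
    speedSq s u i ≤ ‖bondChirality s u i‖ ^ 2 + s * (1 + K) ^ 2 := by
  rw [norm_bondChirality_sq h.pos (h.unit _ (by omega)) (h.unit _ (by omega))]
  suffices s ^ 2 * speedSq s u i ^ 2 / 4 ≤ s * (1 + K) ^ 2 by linarith
  rcases Nat.lt_or_ge (i + 1) N with hlt | hge
  · exact speedSq_mul_sq_le_of_avg h.pos h.le_one (speedSq_nonneg _ _ _)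
      (speedSq_nonneg _ _ _) (h.abs_one_sub_speedSq_le hlt)
  -- The last bond starts no pair of consecutive bonds, so the pair ending at it is used.
  · obtain ⟨j, rfl⟩ : ∃ j, i = j + 1 := ⟨i - 1, by omega⟩
    have h1 := h.abs_one_sub_speedSq_le (i := j) (by omega)
    rw [add_comm (speedSq s u j)] at h1
    exact speedSq_mul_sq_le_of_avg h.pos h.le_one (speedSq_nonneg _ _ _)
      (speedSq_nonneg _ _ _) h1

theorem le_speedSq (h : BoundedChain s K N u) {i : ℕ} (hi : i + 1 ≤ N) :
    ‖bondChirality s u i‖ ^ 2 ≤ speedSq s u i := by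
  rw [norm_bondChirality_sq h.pos (h.unit _ (by omega)) (h.unit _ (by omega))]
  have : 0 ≤ s ^ 2 * speedSq s u i ^ 2 / 4 := by positivity
  linarith

end BoundedChain

/-! ### The truncated Modica–Mortola potential -/

/-- The primitive of `(ρ² - r²)⁺` on `[0, ∞)`. -/
noncomputable def potential (ρ r : ℝ) : ℝ := ρ ^ 2 * min r ρ - min r ρ ^ 3 / 3

theorem potential_of_ge {ρ r : ℝ} (h : ρ ≤ r) : potential ρ r = 2 / 3 * ρ ^ 3 := by
  rw [potential, min_eq_right h]; ring

theorem potential_le {ρ r : ℝ} (hρ : 0 ≤ ρ) (hρ1 : ρ ≤ 1) (hr : 0 ≤ r) : potential ρ r ≤ r := by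
  unfold potential
  have h1 : 0 ≤ min r ρ := le_min hr hρ
  have h2 : min r ρ ≤ r := min_le_left _ _
  have h3 : ρ ^ 2 ≤ 1 := pow_le_one₀ hρ hρ1
  nlinarith [pow_nonneg h1 3]

/-- The derivative (ρ² - r²)⁺ is decreasing, so on `[a, b]` it is at most its value at `a`; beyond ρ
the potential is constant and nothing is required of `e`. -/
theorem abs_potential_sub_le {ρ a b e : ℝ} (hρ : 0 ≤ ρ) (ha : 0 ≤ a) (hab : a ≤ b)
    (he : a < ρ → ρ ^ 2 - a ^ 2 ≤ e) (he0 : 0 ≤ e) :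
    |potential ρ b - potential ρ a| ≤ (b - a) * e := by
  rcases lt_or_ge a ρ with h | h
  · have he := he h
    have h1 : min a ρ = a := min_eq_left h.le
    have h2 : a ≤ min b ρ := le_min hab h.le
    have h3 : min b ρ ≤ ρ := min_le_right _ _
    have h4 : min b ρ ≤ b := min_le_left _ _
    unfold potential
    rw [h1]
    set c := min b ρ
    have h5 : ρ ^ 2 * c - c ^ 3 / 3 - (ρ ^ 2 * a - a ^ 3 / 3) =
      (c - a) * (ρ ^ 2 - (a ^ 2 + a * c + c ^ 2) / 3) := by ring
    have h7 : a ^ 2 ≤ (a ^ 2 + a * c + c ^ 2) / 3 := by nlinarith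
    have h8 : (a ^ 2 + a * c + c ^ 2) / 3 ≤ ρ ^ 2 := by nlinarith
    rw [h5, abs_of_nonneg (mul_nonneg (by linarith) (by linarith))]
    exact mul_le_mul (by linarith) (by linarith) (by linarith) (by linarith)
  · rw [potential_of_ge h, potential_of_ge (h.trans hab), sub_self, abs_zero]
    exact mul_nonneg (by linarith) he0

namespace BoundedChain

variable {s K : ℝ} {N : ℕ} {u : ℕ → E3}

/-- The Modica–Mortola trick on one step. The true weight is 1 - (averaged squared speed), not 1 -
|z|²; the gap 1 - ρ² left by the truncation absorbs both the variation of |z| over the step and the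
difference between speed and chirality. -/
theorem two_mul_abs_potential_step_le (h : BoundedChain s K N u) {ρ : ℝ} (hρ : 0 ≤ ρ)
    (hρ1 : ρ ≤ 1) (hsmall : 2 * (K * √s) + (K * √s) ^ 2 + s * (1 + K) ^ 2 ≤ 1 - ρ ^ 2) {i : ℕ}
    (hi : i + 2 ≤ N) :
    2 * |potential ρ ‖bondChirality s u (i + 1)‖ - potential ρ ‖bondChirality s u i‖| * s ^ 3 ≤
      ‖defect s u i‖ ^ 2 := by
  have hs := h.pos
  set x := bondChirality s u i with hx
  set y := bondChirality s u (i + 1) with hy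
  set e := 1 - (speedSq s u i + speedSq s u (i + 1)) / 2 with he
  have hp0 := h.speedSq_le (i := i) (by omega) (by omega)
  have hp1 := h.speedSq_le (i := i + 1) (by omega) (by omega)
  rw [← hx] at hp0
  rw [← hy] at hp1
  have hd : |‖y‖ - ‖x‖| ≤ K * √s :=
    (abs_norm_sub_norm_le _ _).trans (h.norm_bondChirality_succ_sub_le hi)
  have hD : 0 ≤ K * √s := mul_nonneg h.nonneg (Real.sqrt_nonneg _)
  set D := K * √s
  have key : |potential ρ ‖y‖ - potential ρ ‖x‖| ≤ ‖y - x‖ * |e| := by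
    -- Stated for ordered lengths, so that it serves both for increasing and for decreasing norm.
    have aux : ∀ a b : ℝ, 0 ≤ a → a ≤ b → b ≤ a + D → speedSq s u i + speedSq s u (i + 1) ≤
        2 * b ^ 2 + 2 * (s * (1 + K) ^ 2) →
        |potential ρ b - potential ρ a| ≤ (b - a) * |e| := by
      intro a b ha hab hbD hsp
      refine abs_potential_sub_le hρ ha hab (fun haρ => le_trans ?_ (le_abs_self e))
        (abs_nonneg _)
      have : b ^ 2 ≤ a ^ 2 + 2 * D + D ^ 2 := by nlinarith
      rw [he]; linarith
    rcases le_total ‖x‖ ‖y‖ with hle | hle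
    · refine (aux ‖x‖ ‖y‖ (norm_nonneg _) hle (by linarith [le_abs_self (‖y‖ - ‖x‖)]) ?_).trans
        (mul_le_mul_of_nonneg_right (norm_sub_norm_le _ _) (abs_nonneg _))
      have : ‖x‖ ^ 2 ≤ ‖y‖ ^ 2 := pow_le_pow_left₀ (norm_nonneg _) hle 2
      linarith
    · rw [abs_sub_comm, norm_sub_rev]
      refine (aux ‖y‖ ‖x‖ (norm_nonneg _) hle (by linarith [neg_abs_le (‖y‖ - ‖x‖)]) ?_).trans
        (mul_le_mul_of_nonneg_right (norm_sub_norm_le _ _) (abs_nonneg _))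
      have : ‖y‖ ^ 2 ≤ ‖x‖ ^ 2 := pow_le_pow_left₀ (norm_nonneg _) hle 2
      linarith
  rw [h.norm_defect_sq_eq hi, ← hx, ← hy, ← he]
  -- Young's inequality, balanced between the weights s² and s⁴.
  have h1 : 2 * (‖y - x‖ * |e|) * s ^ 3 ≤ s ^ 2 * ‖y - x‖ ^ 2 + s ^ 4 * e ^ 2 := by
    rw [← sq_abs e]
    nlinarith [sq_nonneg (s * ‖y - x‖ - s ^ 2 * |e|)]
  have h2 := mul_le_mul_of_nonneg_right key (show 0 ≤ 2 * s ^ 3 by positivity)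
  linarith

theorem two_mul_abs_potential_sub_le (h : BoundedChain s K N u) {ρ : ℝ} (hρ : 0 ≤ ρ)
    (hρ1 : ρ ≤ 1) (hsmall : 2 * (K * √s) + (K * √s) ^ 2 + s * (1 + K) ^ 2 ≤ 1 - ρ ^ 2) {a b : ℕ}
    (hab : a ≤ b) (hb : b + 1 ≤ N) :
    2 * |potential ρ ‖bondChirality s u b‖ - potential ρ ‖bondChirality s u a‖| * s ^ 3 ≤
      ∑ i ∈ Finset.Ico a b, ‖defect s u i‖ ^ 2 := by
  induction b, hab using Nat.le_induction with
  | base => simp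
  | succ b hab ih =>
    rw [Finset.sum_Ico_succ_top hab]
    have h1 := ih (by omega)
    have h2 := h.two_mul_abs_potential_step_le hρ hρ1 hsmall (i := b) (by omega)
    have h3 := abs_sub_le (potential ρ ‖bondChirality s u (b + 1)‖)
      (potential ρ ‖bondChirality s u b‖) (potential ρ ‖bondChirality s u a‖)
    have h4 := mul_le_mul_of_nonneg_right h3 (show 0 ≤ 2 * s ^ 3 from by
      have := h.pos; positivity)
    linarith

/-! ### The chirality is nearly parallel to one of the axes -/

/-- The velocity increment is the defect minus s² times a unit vector, so over boundedly many sites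
the velocity changes by o(s), while it is itself s times a quantity of order one where |z| is near
1. -/
theorem norm_velocity_add_sub_le (h : BoundedChain s K N u) {i : ℕ} :
    ∀ {j : ℕ}, i + j + 1 ≤ N →
      ‖(u (i + j + 1) - u (i + j)) - (u (i + 1) - u i)‖ ≤ j * (K * √s * s + s ^ 2)
  | 0, _ => by simp
  | j + 1, hj => by
    have h1 := h.norm_velocity_add_sub_le (i := i) (j := j) (by omega)
    have h2 := h.norm_defect_le (i := i + j) (by omega)
    have h3 : (u (i + (j + 1) + 1) - u (i + (j + 1))) - (u (i + 1) - u i) =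
        defect s u (i + j) - s ^ 2 • u (i + j + 1) +
          ((u (i + j + 1) - u (i + j)) - (u (i + 1) - u i)) := by
      rw [defect, show i + (j + 1) + 1 = i + j + 2 by ring, show i + (j + 1) = i + j + 1 by ring]
      module
    rw [h3]
    refine (norm_add_le _ _).trans ?_
    have h4 := norm_sub_le (defect s u (i + j)) (s ^ 2 • u (i + j + 1))
    rw [norm_smul, h.unit (i + j + 1) (by omega), Real.norm_of_nonneg (by positivity)] at h4
    push_cast
    linarith

/-- Summation of the velocity changes: over a few sites the chain is a straight line up to o(s),
which makes `u (i + j)` usable in place of `u (i + 1)` when computing the chirality. -/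
theorem norm_displacement_sub_le (h : BoundedChain s K N u) {i : ℕ} :
    ∀ {j : ℕ}, i + j ≤ N →
      ‖u (i + j) - u i - (j : ℝ) • (u (i + 1) - u i)‖ ≤ j ^ 2 * (K * √s * s + s ^ 2)
  | 0, _ => by simp
  | j + 1, hj => by
    have h1 := h.norm_displacement_sub_le (i := i) (j := j) (by omega)
    have h2 := h.norm_velocity_add_sub_le (i := i) (j := j) (by omega)
    have h3 : u (i + (j + 1)) - u i - ((j + 1 : ℕ) : ℝ) • (u (i + 1) - u i) =
        (u (i + j) - u i - (j : ℝ) • (u (i + 1) - u i)) +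
          ((u (i + j + 1) - u (i + j)) - (u (i + 1) - u i)) := by
      rw [← add_assoc i j 1]; push_cast; module
    rw [h3]
    refine (norm_add_le _ _).trans ?_
    have hs := h.pos
    have hK := h.nonneg
    have h4 : 0 ≤ K * √s * s + s ^ 2 := by positivity
    push_cast
    nlinarith [mul_nonneg (Nat.cast_nonneg (α := ℝ) j) h4]

/-- Two spins on the great circle orthogonal to `q`, at most `k` sites apart, force the chirality
to be nearly parallel to `q`. -/
theorem exists_norm_bondChirality_sub_smul_le (h : BoundedChain s K N u) {q : E3} (hq : ‖q‖ = 1)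
    {i j k : ℕ} (hj : 1 ≤ j) (hjk : j ≤ k) (hN : i + j ≤ N) (h0 : inner ℝ q (u i) = 0)
    (h1 : inner ℝ q (u (i + j)) = 0) :
    ∃ c : ℝ, ‖bondChirality s u i - c • q‖ ≤ k * (K * √s + s) := by
  have hs := h.pos
  have hK := h.nonneg
  have hj0 : (0 : ℝ) < j := by exact_mod_cast hj
  have hjk' : (j : ℝ) ≤ k := by exact_mod_cast hjk
  refine ⟨(j * s)⁻¹ * inner ℝ q (cross (u i) (u (i + j))), ?_⟩
  have h2 : bondChirality s u i -
      ((j * s)⁻¹ * inner ℝ q (cross (u i) (u (i + j)))) • q =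
      -((j * s)⁻¹ • cross (u i) (u (i + j) - u i - (j : ℝ) • (u (i + 1) - u i))) := by
    rw [mul_smul, ← cross_eq_smul_of_orthogonal hq h0 h1, cross_sub_right, cross_sub_right,
      cross_smul_right, cross_sub_right, cross_self', sub_zero, sub_zero, smul_sub, smul_smul,
      bondChirality, neg_sub, mul_inv, mul_assoc, mul_comm s⁻¹, inv_mul_cancel_left₀ hj0.ne']
  rw [h2, norm_neg, norm_smul, Real.norm_of_nonneg (by positivity)]
  have h3 := (norm_cross_le (u i) (u (i + j) - u i - (j : ℝ) • (u (i + 1) - u i))).trans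
    (mul_le_mul_of_nonneg_left (h.norm_displacement_sub_le hN) (norm_nonneg _))
  rw [h.unit i (by omega), one_mul] at h3
  calc _ ≤ (j * s)⁻¹ * (j ^ 2 * (K * √s * s + s ^ 2)) :=
        mul_le_mul_of_nonneg_left h3 (by positivity)
    _ = j * (K * √s + s) := by field_simp
    _ ≤ k * (K * √s + s) := mul_le_mul_of_nonneg_right hjk' (by positivity)

/-- Pigeonhole: two of the k + 1 spins from site `i` on share a great circle, so the chirality at
the first of them is nearly parallel to its axis. Going back to `i` changes the chirality by at most
K√s per site. -/
theorem exists_axis {k : ℕ} {q : Fin k → E3} (hq : ∀ l, ‖q l‖ = 1) (h : BoundedChain s K N u)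
    (hu : ∀ i ≤ N, u i ∈ circles q) {i : ℕ} (hi : i + k + 1 ≤ N) :
    ∃ p ∈ wells q, ‖bondChirality s u i - ‖bondChirality s u i‖ • p‖ ≤
      2 * (k * (2 * (K * √s) + s)) := by
  have hs := h.pos
  have hK := h.nonneg
  have hl : ∀ j : Fin (k + 1), ∃ l, inner ℝ (q l) (u (i + j)) = 0 := by
    intro j
    have := hu (i + j) (by omega)
    simp only [circles, Set.mem_iUnion, Set.mem_ofPred_eq] at this
    obtain ⟨l, -, h⟩ := this
    exact ⟨l, h⟩
  choose f hf using hl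
  obtain ⟨j, j', hjj, hfj⟩ : ∃ j j' : Fin (k + 1), j < j' ∧ f j = f j' := by
    obtain ⟨a, b, hab, hfab⟩ := Fintype.exists_ne_map_eq_of_card_lt f (by simp)
    rcases lt_or_gt_of_ne hab with hlt | hlt
    exacts [⟨a, b, hlt, hfab⟩, ⟨b, a, hlt, hfab.symm⟩]
  have hlt : (j : ℕ) < j' := hjj
  have h1 := hf j
  have h2 := hf j'
  rw [← hfj, show i + (j' : ℕ) = i + j + (j' - j : ℕ) by omega] at h2
  obtain ⟨c, hc⟩ := h.exists_norm_bondChirality_sub_smul_le (hq (f j)) (k := k) (by omega)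
    (by omega) (by omega) h1 h2
  have h3 := h.norm_bondChirality_add_sub_le (i := i) (j := j) (by omega)
  have hjk : (j : ℝ) ≤ k := by exact_mod_cast Nat.lt_succ_iff.mp j.2
  have h4 : ‖bondChirality s u i - c • q (f j)‖ ≤ k * (2 * (K * √s) + s) := by
    have h5 := norm_sub_le_norm_sub_add_norm_sub (bondChirality s u i)
      (bondChirality s u (i + j)) (c • q (f j))
    rw [norm_sub_rev (bondChirality s u i) (bondChirality s u (i + j))] at h5
    have h6 : (j : ℝ) * (K * √s) ≤ k * (K * √s) :=
      mul_le_mul_of_nonneg_right hjk (by positivity)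
    linarith
  set z := bondChirality s u i
  set ω := k * (2 * (K * √s) + s)
  -- Replacing the unknown multiple |c| by ‖z‖ costs another ω, whence the factor 2; the sign of `c`
  -- selects between the two opposite wells.
  have h7 : abs (‖z‖ - |c|) ≤ ω := by
    have := abs_norm_sub_norm_le z (c • q (f j))
    rw [norm_smul, hq, mul_one, Real.norm_eq_abs] at this
    exact this.trans h4
  have fin : ∀ p : E3, ‖p‖ = 1 → c • q (f j) = |c| • p → ‖z - ‖z‖ • p‖ ≤ 2 * ω := by
    intro p hp hcp
    rw [hcp] at h4
    have h8 : z - ‖z‖ • p = (z - |c| • p) - (‖z‖ - |c|) • p := by module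
    rw [h8]
    refine (norm_sub_le _ _).trans ?_
    rw [norm_smul, hp, mul_one, Real.norm_eq_abs]
    linarith
  rcases le_total 0 c with h0 | h0
  · exact ⟨q (f j), ⟨f j, Or.inl rfl⟩, fin _ (hq _) (by rw [abs_of_nonneg h0])⟩
  · exact ⟨-q (f j), ⟨f j, Or.inr rfl⟩, fin _ (by rw [norm_neg, hq])
      (by rw [abs_of_nonpos h0, neg_smul_neg])⟩

end BoundedChain

/-! ### The finite set of wells and the cost of a transition. -/

theorem norm_eq_one_of_mem_wells {k : ℕ} {q : Fin k → E3} (hq : ∀ l, ‖q l‖ = 1) {p : E3}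
    (hp : p ∈ wells q) : ‖p‖ = 1 := by
  obtain ⟨l, rfl | rfl⟩ := hp
  · exact hq l
  · rw [norm_neg, hq]

theorem finite_wells {k : ℕ} (q : Fin k → E3) : (wells q).Finite := by
  have : wells q = Set.range q ∪ Set.range (fun l => -q l) := by
    ext x
    simp only [wells, Set.mem_ofPred_eq, Set.mem_union, Set.mem_range]
    constructor
    · rintro ⟨l, rfl | rfl⟩
      exacts [Or.inl ⟨l, rfl⟩, Or.inr ⟨l, rfl⟩]
    · rintro (⟨l, rfl⟩ | ⟨l, rfl⟩)
      exacts [⟨l, Or.inl rfl⟩, ⟨l, Or.inr rfl⟩]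
  rw [this]
  exact (Set.finite_range _).union (Set.finite_range _)

theorem exists_pos_le_dist_of_finite {α : Type*} [MetricSpace α] {Q : Set α} (hQ : Q.Finite) :
    ∃ m > 0, ∀ p ∈ Q, ∀ p' ∈ Q, p ≠ p' → m ≤ dist p p' := by
  have hfin : ((Q ×ˢ Q) ∩ {x | x.1 ≠ x.2}).Finite := (hQ.prod hQ).inter_of_left _
  rcases Set.eq_empty_or_nonempty ((Q ×ˢ Q) ∩ {x | x.1 ≠ x.2}) with he | hne
  · refine ⟨1, one_pos, fun p hp p' hp' hne => ?_⟩
    have : (p, p') ∈ (Q ×ˢ Q) ∩ {x | x.1 ≠ x.2} := ⟨⟨hp, hp'⟩, hne⟩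
    rw [he] at this
    exact this.elim
  · obtain ⟨x, hx, hmin⟩ := Set.exists_min_image _ (fun x : α × α => dist x.1 x.2) hfin hne
    exact ⟨dist x.1 x.2, dist_pos.mpr hx.2, fun p hp p' hp' h => hmin (p, p') ⟨⟨hp, hp'⟩, h⟩⟩

/-- Two unit vectors whose multiples are close to the same long vector are close. -/
theorem dist_le_of_near {x y p p' : E3} (hp' : ‖p'‖ = 1) {ω d τ : ℝ} (hτ : 0 < τ)
    (hx : ‖x - ‖x‖ • p‖ ≤ ω) (hy : ‖y - ‖y‖ • p'‖ ≤ ω) (hxy : ‖y - x‖ ≤ d) (hxτ : τ ≤ ‖x‖) :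
    dist p p' ≤ (2 * ω + 2 * d) / τ := by
  have h1 : ‖x‖ • (p - p') =
      (y - ‖y‖ • p') + (‖y‖ - ‖x‖) • p' - (x - ‖x‖ • p) - (y - x) := by module
  have h2 : ‖‖x‖ • (p - p')‖ ≤ 2 * ω + 2 * d := by
    rw [h1]
    have h3 : ‖(‖y‖ - ‖x‖) • p'‖ ≤ d := by
      rw [norm_smul, hp', mul_one]; exact (abs_norm_sub_norm_le _ _).trans hxy
    have := norm_sub_le ((y - ‖y‖ • p') + (‖y‖ - ‖x‖) • p' - (x - ‖x‖ • p)) (y - x)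
    have := norm_sub_le ((y - ‖y‖ • p') + (‖y‖ - ‖x‖) • p') (x - ‖x‖ • p)
    have := norm_add_le (y - ‖y‖ • p') ((‖y‖ - ‖x‖) • p')
    linarith
  rw [norm_smul, norm_norm] at h2
  rw [le_div_iff₀ hτ, dist_eq_norm]
  nlinarith [norm_nonneg (p - p')]

/-- A transition between two different wells carries almost all of the energy `8/3`. -/
theorem BoundedChain.transition_energy_ge {s K : ℝ} {N : ℕ} {u : ℕ → E3} {k : ℕ} {q : Fin k → E3}
    (hq : ∀ l, ‖q l‖ = 1) (h : BoundedChain s K N u) (hu : ∀ i ≤ N, u i ∈ circles q) {m : ℝ}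
    (hm : ∀ p ∈ wells q, ∀ p' ∈ wells q, p ≠ p' → m ≤ dist p p') {ρ τ : ℝ} (hρ : 0 ≤ ρ)
    (hρ1 : ρ ≤ 1) (hτ : 0 < τ)
    (hsmall : 2 * (K * √s) + (K * √s) ^ 2 + s * (1 + K) ^ 2 ≤ 1 - ρ ^ 2)
    (hstep : (4 * (k * (2 * (K * √s) + s)) + 2 * (K * √s)) / τ < m) {a b : ℕ} (hab : a ≤ b)
    (hb : b + k + 1 ≤ N) {p p' : E3} (hp : p ∈ wells q) (hp' : p' ∈ wells q) (hpp : p ≠ p')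
    (ha : ρ ≤ ‖bondChirality s u a‖) (hb' : ρ ≤ ‖bondChirality s u b‖)
    (hclose : 2 * ‖bondChirality s u a - p‖ + 2 * ‖bondChirality s u b - p'‖ +
      4 * (k * (2 * (K * √s) + s)) < m) :
    (8 / 3 * ρ ^ 3 - 4 * τ) * s ^ 3 ≤ ∑ i ∈ Finset.Ico a b, ‖defect s u i‖ ^ 2 := by
  have hs := h.pos
  set ω := k * (2 * (K * √s) + s)
  have hax : ∀ i, ∃ p : E3, i ≤ b → p ∈ wells q ∧
      ‖bondChirality s u i - ‖bondChirality s u i‖ • p‖ ≤ 2 * ω := by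
    intro i
    by_cases hi : i ≤ b
    · obtain ⟨p, h1, h2⟩ := BoundedChain.exists_axis hq h hu (i := i) (by omega)
      exact ⟨p, fun _ => ⟨h1, h2⟩⟩
    · exact ⟨0, fun h => absurd h hi⟩
  choose f hf using hax
  have hnorm : ∀ i ≤ b, ‖f i‖ = 1 := fun i hi => norm_eq_one_of_mem_wells hq (hf i hi).1
  have hend : ∀ i ≤ b, ∀ p ∈ wells q, dist p (f i) ≤ 2 * ‖bondChirality s u i - p‖ + 2 * ω := by
    intro i hi p hp
    have h1 := (hf i hi).2
    have hp1 := norm_eq_one_of_mem_wells hq hp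
    set z := bondChirality s u i
    have h2 : p - f i = -(z - p) + (z - ‖z‖ • f i) + (‖z‖ - 1) • f i := by module
    have h3 : ‖(‖z‖ - 1) • f i‖ ≤ ‖z - p‖ := by
      rw [norm_smul, hnorm i hi, mul_one, Real.norm_eq_abs, ← hp1]
      exact abs_norm_sub_norm_le _ _
    rw [dist_eq_norm, h2]
    have h4 := norm_add_le (-(z - p) + (z - ‖z‖ • f i)) ((‖z‖ - 1) • f i)
    have h5 := norm_add_le (-(z - p)) (z - ‖z‖ • f i)
    rw [norm_neg] at h5
    linarith
  -- If the chirality were never shorter than τ, neighbouring axes would be closer than the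
  -- separation m of the wells, hence equal all the way from `a` to `b`, against `p ≠ p'`.
  obtain ⟨c, hac, hcb, hc⟩ : ∃ c, a ≤ c ∧ c ≤ b ∧ ‖bondChirality s u c‖ < τ := by
    by_contra! hcon
    have hconst : ∀ c, a ≤ c → c ≤ b → f c = f a := by
      intro c hac
      induction c, hac using Nat.le_induction with
      | base => exact fun _ => rfl
      | succ c hac ih =>
        intro hcb
        rw [← ih (by omega)]
        by_contra hne
        have h1 := hm _ (hf c (by omega)).1 _ (hf (c + 1) hcb).1 (Ne.symm hne)
        have h2 := dist_le_of_near (hnorm (c + 1) hcb) hτ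
          (hf c (by omega)).2 (hf (c + 1) hcb).2 (h.norm_bondChirality_succ_sub_le (by omega))
          (hcon c hac (by omega))
        have h3 : 2 * (2 * ω) + 2 * (K * √s) = 4 * ω + 2 * (K * √s) := by ring
        rw [h3] at h2
        linarith
    have h1 := hend a hab p hp
    have h2 := hend b le_rfl p' hp'
    rw [hconst b hab le_rfl, dist_comm] at h2
    have h3 := dist_triangle p (f a) p'
    have h4 := hm p hp p' hp' hpp
    linarith
  -- The potential is 2ρ³/3 at both ends and at most τ at `c`, so each half of the path contributes
  -- at least 2 (2ρ³/3 - τ).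
  have e1 := h.two_mul_abs_potential_sub_le hρ hρ1 hsmall hac (by omega)
  have e2 := h.two_mul_abs_potential_sub_le hρ hρ1 hsmall hcb (by omega)
  rw [← Finset.sum_Ico_consecutive _ hac hcb]
  rw [potential_of_ge ha] at e1
  rw [potential_of_ge hb'] at e2
  have h1 := potential_le hρ hρ1 (norm_nonneg (bondChirality s u c))
  have hs3 : 0 < s ^ 3 := by positivity
  have h2 := mul_le_mul_of_nonneg_right
    (neg_abs_le (potential ρ ‖bondChirality s u c‖ - 2 / 3 * ρ ^ 3)) hs3.le
  have h3 := mul_le_mul_of_nonneg_right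
    (le_abs_self (2 / 3 * ρ ^ 3 - potential ρ ‖bondChirality s u c‖)) hs3.le
  have h4 := mul_le_mul_of_nonneg_right (h1.trans hc.le) hs3.le
  linarith

/-! ### Approximate limits and piecewise constant functions -/

/-- `a` is the approximate limit of `z` at `x`. -/
def HasApproxLimit (z : ℝ → E3) (x : ℝ) (a : E3) : Prop :=
  Tendsto (fun r : ℝ => ⨍ y in Metric.ball x r, ‖z y - a‖) (𝓝[>] 0) (𝓝 0)

theorem exists_hasApproxLimit {z : ℝ → E3} {x : ℝ} (hx : x ∈ Set.Ioo (0 : ℝ) 1)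
    (hj : x ∉ jumpSet z) : ∃ a, HasApproxLimit z x a := by
  by_contra h
  exact hj ⟨hx, h⟩

theorem exists_ball_subset {x a b : ℝ} (hx : x ∈ Set.Ioo a b) :
    ∃ r > 0, Metric.ball x r ⊆ Set.Ioo a b :=
  Metric.isOpen_iff.mp isOpen_Ioo x hx

theorem setAverage_ball_eq (f : ℝ → ℝ) (x : ℝ) {r : ℝ} (hr : 0 < r) :
    ⨍ y in Metric.ball x r, f y = (2 * r)⁻¹ * ∫ y in Metric.ball x r, f y := by
  rw [setAverage_eq, Real.volume_real_ball hr.le, smul_eq_mul]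

theorem integrableOn_const_ball {F : Type*} [NormedAddCommGroup F] (a : F) (x r : ℝ) :
    IntegrableOn (fun _ : ℝ => a) (Metric.ball x r) :=
  integrableOn_const (by rw [Real.volume_ball]; exact ENNReal.ofReal_ne_top) (by simp)

theorem hasDerivWithinAt_const_inner (v : E3) {f : ℝ → E3} {f' : E3} {s : Set ℝ} {x : ℝ}
    (h : HasDerivWithinAt f f' s x) :
    HasDerivWithinAt (fun y => (inner ℝ v (f y) : ℝ)) (inner ℝ v f') s x :=
  (innerSL ℝ v).hasFDerivAt.comp_hasDerivWithinAt x h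

/-- The inclusion holds only up to the endpoint `y`, which may lie in the interval but not in the
open ball. -/
theorem uIoc_ae_le_ball (x y : ℝ) : Set.uIoc x y ≤ᵐ[volume] Metric.ball x |y - x| := by
  have h : (Metric.ball x |y - x| : Set ℝ) =ᵐ[volume] Set.Icc (x - |y - x|) (x + |y - x|) := by
    rw [Real.ball_eq_Ioo]; exact Ioo_ae_eq_Icc
  refine (LE.le.eventuallyLE fun t ht => ?_).trans h.symm.le
  have ht' : t ∈ Set.uIcc x y := Set.uIoc_subset_uIcc ht
  have h1 := Set.abs_sub_left_of_mem_uIcc ht'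
  rw [abs_le] at h1
  exact ⟨by linarith [h1.1], by linarith [h1.2]⟩

/-- The error of the difference quotient at `y` is at most twice the average of ‖z - a‖ over the
ball of radius |y - x|, whose length is 2|y - x|. -/
theorem HasApproxLimit.hasDerivAt_integral {z : ℝ → E3} (hz : IntegrableOn z (Set.Ioo 0 1))
    {x : ℝ} (hx : x ∈ Set.Ioo (0 : ℝ) 1) {a : E3} (h : HasApproxLimit z x a) :
    HasDerivAt (fun y => ∫ t in (0 : ℝ)..y, z t) a x := by
  rw [hasDerivAt_iff_isLittleO, Asymptotics.isLittleO_iff]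
  intro ε hε
  obtain ⟨r, hr, hball⟩ := exists_ball_subset hx
  have h1 : ∀ᶠ t : ℝ in 𝓝[>] 0, ⨍ y in Metric.ball x t, ‖z y - a‖ < ε / 2 :=
    h.eventually (gt_mem_nhds (half_pos hε))
  obtain ⟨r', hr', h1⟩ := mem_nhdsGT_iff_exists_Ioo_subset.mp h1
  filter_upwards [Metric.ball_mem_nhds x (lt_min hr hr')] with y hy
  rw [Metric.mem_ball, Real.dist_eq, lt_min_iff] at hy
  rcases eq_or_ne y x with rfl | hne
  · simp
  have hpos : 0 < |y - x| := abs_pos.mpr (sub_ne_zero.mpr hne)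
  have hint : ∀ y ∈ Set.Ioo (0 : ℝ) 1, IntervalIntegrable z volume 0 y := fun y hy =>
    (intervalIntegrable_iff_integrableOn_Ioo_of_le hy.1.le).mpr
      (hz.mono_set (Set.Ioo_subset_Ioo_right hy.2.le))
  have hy1 : y ∈ Set.Ioo (0 : ℝ) 1 := hball (by rw [Metric.mem_ball, Real.dist_eq]; exact hy.1)
  have hxy := (hint x hx).symm.trans (hint y hy1)
  rw [intervalIntegral.integral_interval_sub_left (hint y hy1) (hint x hx),
    ← intervalIntegral.integral_const, ← intervalIntegral.integral_sub hxy (by simp)]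
  refine (intervalIntegral.norm_integral_le_integral_norm_uIoc).trans ?_
  have hsub : Metric.ball x |y - x| ⊆ Set.Ioo 0 1 :=
    (Metric.ball_subset_ball hy.1.le).trans hball
  have hi : IntegrableOn (fun t => ‖z t - a‖) (Metric.ball x |y - x|) :=
    ((hz.mono_set hsub).sub (integrableOn_const_ball a x _)).norm
  refine (setIntegral_mono_set hi (Filter.Eventually.of_forall fun _ => norm_nonneg _)
    (uIoc_ae_le_ball x y)).trans ?_
  have h2 : ⨍ t in Metric.ball x |y - x|, ‖z t - a‖ < ε / 2 := h1 ⟨hpos, hy.2⟩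
  rw [setAverage_ball_eq _ _ hpos, inv_mul_lt_iff₀ (by positivity)] at h2
  rw [Real.norm_eq_abs]
  linarith

/-- Outside the closed set `Q` the point `a` has a positive distance m from it, and every average of
‖z - a‖ on a small ball is then at least m. -/
theorem HasApproxLimit.mem_of_finite {z : ℝ → E3} (hz : IntegrableOn z (Set.Ioo 0 1)) {Q : Set E3}
    (hQ : Q.Finite) (hzQ : ∀ᵐ y ∂volI, z y ∈ Q) {x : ℝ} (hx : x ∈ Set.Ioo (0 : ℝ) 1) {a : E3}
    (h : HasApproxLimit z x a) : a ∈ Q := by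
  by_contra ha
  obtain ⟨m, hm, hmQ⟩ : ∃ m > 0, ∀ p ∈ Q, m ≤ ‖p - a‖ := by
    have : Qᶜ ∈ 𝓝 a := hQ.isClosed.isOpen_compl.mem_nhds ha
    obtain ⟨m, hm, hball⟩ := Metric.mem_nhds_iff.mp this
    refine ⟨m, hm, fun p hp => ?_⟩
    by_contra! hlt
    exact hball (by rwa [Metric.mem_ball, dist_eq_norm]) hp
  obtain ⟨r, hr, hball⟩ := exists_ball_subset hx
  have h1 : ∀ᶠ t : ℝ in 𝓝[>] 0, ⨍ y in Metric.ball x t, ‖z y - a‖ < m :=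
    h.eventually (gt_mem_nhds hm)
  obtain ⟨t, ht, htr, ht0⟩ := (h1.and ((eventually_nhdsWithin_of_eventually_nhds
    (gt_mem_nhds hr)).and self_mem_nhdsWithin)).exists
  have ht0 : 0 < t := ht0
  have hsub : Metric.ball x t ⊆ Set.Ioo 0 1 := (Metric.ball_subset_ball htr.le).trans hball
  have hc : IntegrableOn (fun _ : ℝ => a) (Metric.ball x t) :=
    integrableOn_const_ball _ _ _
  have hcm : IntegrableOn (fun _ : ℝ => m) (Metric.ball x t) :=
    integrableOn_const_ball _ _ _
  have h2 : ∫ y in Metric.ball x t, m ≤ ∫ y in Metric.ball x t, ‖z y - a‖ := by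
    refine integral_mono_ae hcm ((hz.mono_set hsub).sub hc).norm ?_
    have : ∀ᵐ y ∂volume.restrict (Metric.ball x t), z y ∈ Q :=
      ae_restrict_of_ae_restrict_of_subset hsub hzQ
    filter_upwards [this] with y hy using hmQ _ hy
  rw [setAverage_ball_eq _ _ ht0, inv_mul_lt_iff₀ (by positivity)] at ht
  rw [setIntegral_const, Real.volume_real_ball ht0.le, smul_eq_mul] at h2
  linarith

theorem subsingleton_of_ordConnected_of_finite {s : Set ℝ} (h : s.OrdConnected) (hf : s.Finite) :
    s.Subsingleton := by
  intro x hx y hy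
  by_contra hne
  rcases lt_or_gt_of_ne hne with hlt | hlt
  · exact Set.Icc_infinite hlt (hf.subset (h.out hx hy))
  · exact Set.Icc_infinite hlt (hf.subset (h.out hy hx))

/-- A function with values in a finite set is constant on every interval on which it has an
approximate limit everywhere. -/
theorem exists_ae_eq_const {z : ℝ → E3} (hz : IntegrableOn z (Set.Ioo 0 1)) {Q : Set E3}
    (hQ : Q.Finite) (hzQ : ∀ᵐ y ∂volI, z y ∈ Q) {a b : ℝ} (ha : 0 ≤ a) (hab : a < b) (hb : b ≤ 1)
    (hj : ∀ x ∈ Set.Ioo a b, x ∉ jumpSet z) :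
    ∃ p ∈ Q, ∀ᵐ y, y ∈ Set.Ioo a b → z y = p := by
  have hsub : Set.Ioo a b ⊆ Set.Ioo 0 1 := Set.Ioo_subset_Ioo ha hb
  have hex : ∀ x, ∃ A : E3, x ∈ Set.Ioo a b → HasApproxLimit z x A := by
    intro x
    by_cases hx : x ∈ Set.Ioo a b
    · obtain ⟨A, hA⟩ := exists_hasApproxLimit (hsub hx) (hj x hx)
      exact ⟨A, fun _ => hA⟩
    · exact ⟨0, fun h => absurd h hx⟩
  choose A hA using hex
  have hAQ : ∀ x ∈ Set.Ioo a b, A x ∈ Q := fun x hx => (hA x hx).mem_of_finite hz hQ hzQ (hsub hx)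
  have hd : ∀ x ∈ Set.Ioo a b, HasDerivAt (fun y => ∫ t in (0 : ℝ)..y, z t) (A x) x :=
    fun x hx => (hA x hx).hasDerivAt_integral hz (hsub hx)
  -- Darboux: the derivative of a scalar function has an order-connected image of an interval, and
  -- here that image is finite, so it is a point. The direction A x - A y reduces the vector case to
  -- the scalar one.
  have hconst : ∀ x ∈ Set.Ioo a b, ∀ y ∈ Set.Ioo a b, A x = A y := by
    intro x hx y hy
    set v := A x - A y with hv
    have h1 : ((fun t => (inner ℝ v (A t) : ℝ)) '' Set.Ioo a b).OrdConnected :=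
      Set.ordConnected_Ioo.image_hasDerivWithinAt (f := fun y => inner ℝ v (∫ t in (0 : ℝ)..y, z t))
        fun t ht => hasDerivWithinAt_const_inner v (hd t ht).hasDerivWithinAt
    have h2 : ((fun t => (inner ℝ v (A t) : ℝ)) '' Set.Ioo a b).Finite := by
      refine (hQ.image fun p => (inner ℝ v p : ℝ)).subset ?_
      rintro _ ⟨t, ht, rfl⟩
      exact ⟨A t, hAQ t ht, rfl⟩
    have h3 : (inner ℝ v (A x) : ℝ) = inner ℝ v (A y) :=
      subsingleton_of_ordConnected_of_finite h1 h2 ⟨x, hx, rfl⟩ ⟨y, hy, rfl⟩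
    rw [← sub_eq_zero, ← inner_sub_right, ← hv, inner_self_eq_zero] at h3
    exact sub_eq_zero.mp h3
  have hmid : (a + b) / 2 ∈ Set.Ioo a b := ⟨by linarith, by linarith⟩
  refine ⟨A ((a + b) / 2), hAQ _ hmid, ?_⟩
  have hii : IntervalIntegrable z volume 0 1 :=
    (intervalIntegrable_iff_integrableOn_Ioo_of_le zero_le_one).mpr hz
  -- Lebesgue differentiation identifies `z` almost everywhere with the derivative of its primitive.
  filter_upwards [hii.ae_hasDerivAt_integral] with y hy hyab
  rw [Set.uIcc_of_le zero_le_one] at hy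
  rw [← hconst y hyab _ hmid]
  exact (hy (Set.Ioo_subset_Icc_self (hsub hyab)) 0 ⟨le_rfl, zero_le_one⟩).unique (hd y hyab)

/-- Otherwise `z` would be almost everywhere constant near `x` and would have an approximate limit
there. The predicate `P` allows both points to be taken where pointwise convergence holds. -/
theorem exists_ne_near_of_mem_jumpSet {z : ℝ → E3} {x : ℝ} (hx : x ∈ jumpSet z) {P : ℝ → Prop}
    (hP : ∀ᵐ y ∂volI, P y) {ρ : ℝ} (hρ : 0 < ρ) (hsub : Metric.ball x ρ ⊆ Set.Ioo 0 1) :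
    ∃ y y', y < y' ∧ y ∈ Metric.ball x ρ ∧ y' ∈ Metric.ball x ρ ∧ P y ∧ P y' ∧ z y ≠ z y' := by
  by_contra! hcon
  have hae : ∀ᵐ y ∂volume.restrict (Metric.ball x ρ), P y ∧ y ∈ Metric.ball x ρ :=
    (ae_restrict_of_ae_restrict_of_subset hsub hP).and
      (ae_restrict_mem Metric.isOpen_ball.measurableSet)
  have hne : (ae (volume.restrict (Metric.ball x ρ))).NeBot := by
    rw [ae_neBot, Ne, Measure.restrict_eq_zero, Real.volume_ball]
    simp [hρ]
  obtain ⟨y0, hy0, hy0b⟩ := hae.exists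
  have hconst : ∀ᵐ y ∂volume.restrict (Metric.ball x ρ), z y = z y0 := by
    filter_upwards [hae] with y hy
    rcases lt_trichotomy y y0 with hlt | rfl | hlt
    · exact hcon y y0 hlt hy.2 hy0b hy.1 hy0
    · rfl
    · exact (hcon y0 y hlt hy0b hy.2 hy0 hy.1).symm
  refine hx.2 ⟨z y0, ?_⟩
  refine tendsto_const_nhds.congr' ?_
  filter_upwards [Ioo_mem_nhdsGT hρ] with r hr
  have h1 : ∫ y in Metric.ball x r, ‖z y - z y0‖ = 0 := by
    refine integral_eq_zero_of_ae ?_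
    filter_upwards [ae_restrict_of_ae_restrict_of_subset (Metric.ball_subset_ball hr.2.le) hconst]
      with y hy
    simp [hy]
  rw [setAverage_ball_eq _ _ hr.1, h1, mul_zero]

/-- The partition of `[0, 1]` by a finite subset of the open interval. -/
theorem exists_partition {S : Set ℝ} (hS : S.Finite) (hS01 : S ⊆ Set.Ioo 0 1) :
    ∃ x : ℕ → ℝ, x 0 = 0 ∧ x (S.ncard + 1) = 1 ∧ (∀ j ≤ S.ncard, x j < x (j + 1)) ∧
      ∀ j ≤ S.ncard, ∀ y ∈ Set.Ioo (x j) (x (j + 1)), y ∉ S := by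
  classical
  set m := S.ncard
  set F : Finset ℝ := insert 0 (insert 1 hS.toFinset) with hF
  have hcard : F.card = m + 2 := by
    rw [hF, Finset.card_insert_of_notMem, Finset.card_insert_of_notMem,
      ← Set.ncard_eq_toFinset_card S hS]
    · simp only [Set.Finite.mem_toFinset]; exact fun h => lt_irrefl _ (hS01 h).2
    · simp only [Finset.mem_insert, Set.Finite.mem_toFinset, not_or]
      exact ⟨zero_ne_one, fun h => lt_irrefl _ (hS01 h).1⟩
  have hF01 : ∀ y ∈ F, 0 ≤ y ∧ y ≤ 1 := by
    intro y hy
    simp only [hF, Finset.mem_insert, Set.Finite.mem_toFinset] at hy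
    rcases hy with rfl | rfl | hy
    · simp
    · simp
    · exact ⟨(hS01 hy).1.le, (hS01 hy).2.le⟩
  set e := F.orderEmbOfFin hcard
  have hrange : ∀ y ∈ F, ∃ i, e i = y := by
    intro y hy
    have : y ∈ Set.range e := by rw [Finset.range_orderEmbOfFin]; exact hy
    exact this
  have hmem : ∀ i, e i ∈ F := Finset.orderEmbOfFin_mem F hcard
  -- The increasing enumeration of S ∪ {0, 1}, which has m + 2 elements; the value 0 past the end is
  -- irrelevant.
  refine ⟨fun j => if h : j < m + 2 then e ⟨j, h⟩ else 0, ?_, ?_, ?_, ?_⟩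
  · beta_reduce
    rw [dif_pos (by omega)]
    obtain ⟨i, hi⟩ := hrange 0 (by simp [hF])
    refine le_antisymm ?_ (hF01 _ (hmem _)).1
    rw [← hi]
    exact e.monotone (Fin.mk_le_of_le_val (Nat.zero_le _))
  · beta_reduce
    rw [dif_pos (by omega)]
    obtain ⟨i, hi⟩ := hrange 1 (by simp [hF])
    refine le_antisymm (hF01 _ (hmem _)).2 ?_
    rw [← hi]
    exact e.monotone (Fin.le_def.mpr (Nat.lt_succ_iff.mp i.2))
  · intro j hj
    beta_reduce
    rw [dif_pos (by omega), dif_pos (by omega)]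
    exact e.strictMono (Fin.mk_lt_mk.mpr (Nat.lt_succ_self j))
  · intro j hj y hy hyS
    beta_reduce at hy
    rw [dif_pos (by omega), dif_pos (by omega)] at hy
    obtain ⟨i, rfl⟩ := hrange y (by simp [hF, hyS])
    have h1 := e.lt_iff_lt.mp hy.1
    have h2 := e.lt_iff_lt.mp hy.2
    rw [Fin.lt_def] at h1 h2
    simp only at h1 h2
    omega

theorem exists_piecewise_const {z : ℝ → E3} (hz : IntegrableOn z (Set.Ioo 0 1)) {Q : Set E3}
    (hQ : Q.Finite) (hzQ : ∀ᵐ y ∂volI, z y ∈ Q) (hS : (jumpSet z).Finite) :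
    ∃ (x : ℕ → ℝ) (p : ℕ → E3), x 0 = 0 ∧ x ((jumpSet z).ncard + 1) = 1 ∧
      (∀ j ≤ (jumpSet z).ncard, x j < x (j + 1)) ∧ (∀ j ≤ (jumpSet z).ncard, p j ∈ Q) ∧
      ∀ j ≤ (jumpSet z).ncard, ∀ᵐ y, y ∈ Set.Ioo (x j) (x (j + 1)) → z y = p j := by
  obtain ⟨x, h0, h1, hlt, hns⟩ := exists_partition hS (fun y hy => hy.1)
  have hge : ∀ j ≤ (jumpSet z).ncard + 1, 0 ≤ x j := by
    intro j
    induction j with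
    | zero => intro _; exact h0.ge
    | succ j ih => intro hj; exact (ih (by omega)).trans (hlt j (by omega)).le
  have hle : ∀ j ≤ (jumpSet z).ncard + 1, x j ≤ 1 := by
    intro j hj
    induction hj using Nat.decreasingInduction with
    | self => exact h1.le
    | of_succ j hj ih => exact (hlt j (by omega)).le.trans ih
  have hex : ∀ j, ∃ p : E3, j ≤ (jumpSet z).ncard →
      p ∈ Q ∧ ∀ᵐ y, y ∈ Set.Ioo (x j) (x (j + 1)) → z y = p := by
    intro j
    by_cases hj : j ≤ (jumpSet z).ncard
    · obtain ⟨p, hp, hpz⟩ := exists_ae_eq_const hz hQ hzQ (hge j (by omega)) (hlt j hj)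
        (hle (j + 1) (by omega)) (hns j hj)
      exact ⟨p, fun _ => ⟨hp, hpz⟩⟩
    · exact ⟨0, fun h => absurd h hj⟩
  choose p hp using hex
  exact ⟨x, p, h0, h1, hlt, fun j hj => (hp j hj).1, fun j hj => (hp j hj).2⟩

/-- On each piece the integral is an increment of the scalar product of φ with a fixed vector, hence
at most 2‖p j‖. Only finiteness is needed, so the jumps are not computed. -/
theorem totalVariation_lt_top {z : ℝ → E3} {m : ℕ} {x : ℕ → ℝ} {p : ℕ → E3} (h0 : x 0 = 0)
    (h1 : x (m + 1) = 1) (hlt : ∀ j ≤ m, x j < x (j + 1))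
    (hz : ∀ j ≤ m, ∀ᵐ y, y ∈ Set.Ioo (x j) (x (j + 1)) → z y = p j) :
    totalVariation z < ∞ := by
  refine lt_of_le_of_lt (b := ENNReal.ofReal (∑ j ∈ Finset.range (m + 1), ‖p j‖ * 2)) ?_
    ENNReal.ofReal_lt_top
  refine iSup₂_le fun φ hφ => ENNReal.ofReal_le_ofReal ?_
  obtain ⟨hφ1, -, -, hφb⟩ := hφ
  have hcont : Continuous (deriv φ) := hφ1.continuous_deriv le_rfl
  have hae : ∀ j ≤ m, ∀ᵐ y, y ∈ Set.uIoc (x j) (x (j + 1)) →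
      (inner ℝ (z y) (deriv φ y) : ℝ) = inner ℝ (p j) (deriv φ y) := by
    intro j hj
    have hne : ∀ᵐ y : ℝ, y ≠ x (j + 1) := by simp [ae_iff, measure_singleton]
    filter_upwards [hz j hj, hne] with y hy hyne hmem
    rw [Set.uIoc_of_le (hlt j hj).le] at hmem
    rw [hy ⟨hmem.1, lt_of_le_of_ne hmem.2 hyne⟩]
  have hci : ∀ (v : E3) a b, IntervalIntegrable (fun y => (inner ℝ v (deriv φ y) : ℝ)) volume a b :=
    fun v a b => (continuous_const.inner hcont).intervalIntegrable a b
  have hsum := intervalIntegral.sum_integral_adjacent_intervals (μ := volume) (a := x) (n := m + 1)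
    (f := fun y => (inner ℝ (z y) (deriv φ y) : ℝ)) (fun j hj =>
      (hci (p j) _ _).congr_ae (by
        rw [Filter.EventuallyEq, ae_restrict_iff' measurableSet_uIoc]
        filter_upwards [hae j (by omega)] with y hy hm using (hy hm).symm))
  rw [h0, h1, intervalIntegral.integral_of_le zero_le_one, integral_Ioc_eq_integral_Ioo] at hsum
  rw [volI, ← hsum]
  refine Finset.sum_le_sum fun j hj => ?_
  have hj : j ≤ m := Nat.lt_succ_iff.mp (Finset.mem_range.mp hj)
  rw [intervalIntegral.integral_congr_ae (hae j hj)]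
  have hder : ∀ y, HasDerivAt (fun y => (inner ℝ (p j) (φ y) : ℝ)) (inner ℝ (p j) (deriv φ y)) y :=
    fun y => (innerSL ℝ (p j)).hasFDerivAt.comp_hasDerivAt y
      (hφ1.differentiable one_ne_zero y).hasDerivAt
  rw [intervalIntegral.integral_eq_sub_of_hasDerivAt (fun y _ => hder y) (hci _ _ _),
    ← inner_sub_right]
  refine (real_inner_le_norm _ _).trans (mul_le_mul_of_nonneg_left ?_ (norm_nonneg _))
  have := norm_sub_le (φ (x (j + 1))) (φ (x j))
  have := hφb (x j)
  have := hφb (x (j + 1))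
  linarith

/-! ### The lower bound -/

/-- The length scale `√(2 δ)` of the step between neighbouring spins. -/
noncomputable def stepScale (delta : ℝ) : ℝ := √(2 * delta)

theorem chirality_eq_bondChirality {lam delta : ℝ} {u : ℕ → E3} {i : ℕ}
    (hi : i + 1 ≤ lastIdx lam) : chirality lam delta u i = bondChirality (stepScale delta) u i := by
  rw [chirality, bondChirality, min_eq_left (by omega), stepScale]

theorem eventually_floor_add_le {lam : ℕ → ℝ} (hlam : ∀ n, 0 < lam n)
    (hlim : Tendsto lam atTop (𝓝 0)) {x : ℝ} (hx0 : 0 ≤ x) (hx : x < 1) (c : ℕ) :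
    ∀ᶠ n in atTop, ⌊x / lam n⌋₊ + c ≤ lastIdx (lam n) := by
  have hc : (0 : ℝ) < (1 - x) / (c + 1) := div_pos (by linarith) (by positivity)
  filter_upwards [hlim.eventually (gt_mem_nhds hc)] with n hn
  rw [lastIdx, ← Nat.floor_add_natCast (div_nonneg hx0 (hlam n).le)]
  refine Nat.floor_le_floor ?_
  rw [lt_div_iff₀ (by positivity)] at hn
  have : (c : ℝ) * lam n ≤ 1 - x := by nlinarith [hlam n]
  rw [div_add' _ _ _ (hlam n).ne']
  exact div_le_div_of_nonneg_right (by linarith) (hlam n).le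

/-- A sequence of bounded chains with values in `M_k` whose chiralities converge almost
everywhere to `z`. -/
structure ConvergentChains {k : ℕ} (q : Fin k → E3) (K : ℝ) (lam delta : ℕ → ℝ)
    (u : ℕ → ℕ → E3) (z : ℝ → E3) : Prop where
  lam_pos : ∀ n, 0 < lam n
  lam_lim : Tendsto lam atTop (𝓝 0)
  scale_lim : Tendsto (fun n => stepScale (delta n)) atTop (𝓝 0)
  ratio_lim : Tendsto (fun n => lam n / stepScale (delta n)) atTop (𝓝 0)
  chain : ∀ n, BoundedChain (stepScale (delta n)) K (lastIdx (lam n)) (u n)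
  mem : ∀ n, ∀ i ≤ lastIdx (lam n), u n i ∈ circles q
  lim : ∀ᵐ x ∂volI, Tendsto (fun n => chiralityFun (lam n) (delta n) (u n) x) atTop (𝓝 (z x))

namespace ConvergentChains

variable {k : ℕ} {q : Fin k → E3} {K : ℝ} {lam delta : ℕ → ℝ} {u : ℕ → ℕ → E3} {z : ℝ → E3}

theorem tendsto_mul_sqrt (h : ConvergentChains q K lam delta u z) :
    Tendsto (fun n => K * √(stepScale (delta n))) atTop (𝓝 0) := by
  have := (h.scale_lim.sqrt).const_mul K
  rwa [Real.sqrt_zero, mul_zero] at this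

theorem tendsto_axis_error (h : ConvergentChains q K lam delta u z) :
    Tendsto (fun n => k * (2 * (K * √(stepScale (delta n))) + stepScale (delta n))) atTop
      (𝓝 0) := by
  have := (((h.tendsto_mul_sqrt.const_mul 2).add h.scale_lim).const_mul (k : ℝ))
  simpa using this

theorem tendsto_bondChirality (h : ConvergentChains q K lam delta u z) {x : ℝ}
    (hx : x ∈ Set.Ioo (0 : ℝ) 1)
    (hlim : Tendsto (fun n => chiralityFun (lam n) (delta n) (u n) x) atTop (𝓝 (z x))) :
    Tendsto (fun n => bondChirality (stepScale (delta n)) (u n) ⌊x / lam n⌋₊) atTop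
      (𝓝 (z x)) := by
  refine hlim.congr' ?_
  filter_upwards [eventually_floor_add_le h.lam_pos h.lam_lim hx.1.le hx.2 1] with n hn
  rw [chiralityFun, chirality_eq_bondChirality hn]

/-- Consecutive chiralities differ by at most K√s, so both bonds have the same limit, and each
squared speed is squeezed between |z|² and |z|² + s (1 + K)². -/
theorem tendsto_speed_defect (h : ConvergentChains q K lam delta u z) {x : ℝ}
    (hx : x ∈ Set.Ioo (0 : ℝ) 1)
    (hlim : Tendsto (fun n => chiralityFun (lam n) (delta n) (u n) x) atTop (𝓝 (z x))) :
    Tendsto (fun n => 1 - (speedSq (stepScale (delta n)) (u n) ⌊x / lam n⌋₊ +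
      speedSq (stepScale (delta n)) (u n) (⌊x / lam n⌋₊ + 1)) / 2) atTop
      (𝓝 (1 - ‖z x‖ ^ 2)) := by
  have hz0 := h.tendsto_bondChirality hx hlim
  have hev := eventually_floor_add_le h.lam_pos h.lam_lim hx.1.le hx.2 2
  have hd : Tendsto (fun n => bondChirality (stepScale (delta n)) (u n) (⌊x / lam n⌋₊ + 1) -
      bondChirality (stepScale (delta n)) (u n) ⌊x / lam n⌋₊) atTop (𝓝 0) := by
    refine squeeze_zero_norm' ?_ h.tendsto_mul_sqrt
    filter_upwards [hev] with n hn using (h.chain n).norm_bondChirality_succ_sub_le hn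
  have hz1 : Tendsto (fun n => bondChirality (stepScale (delta n)) (u n) (⌊x / lam n⌋₊ + 1))
      atTop (𝓝 (z x)) := by
    have := hd.add hz0
    simpa using this
  have herr : Tendsto (fun n => stepScale (delta n) * (1 + K) ^ 2) atTop (𝓝 0) := by
    have := h.scale_lim.mul_const ((1 + K) ^ 2)
    rwa [zero_mul] at this
  have hsp : ∀ i : ℕ → ℕ, (∀ᶠ n in atTop, 2 ≤ lastIdx (lam n) ∧ i n + 1 ≤ lastIdx (lam n)) →
      Tendsto (fun n => bondChirality (stepScale (delta n)) (u n) (i n)) atTop (𝓝 (z x)) →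
      Tendsto (fun n => speedSq (stepScale (delta n)) (u n) (i n)) atTop (𝓝 (‖z x‖ ^ 2)) := by
    intro i hi hz
    have h1 := (hz.norm.pow 2)
    have h2 := h1.add herr
    rw [add_zero] at h2
    refine tendsto_of_tendsto_of_tendsto_of_le_of_le' h1 h2 ?_ ?_
    · filter_upwards [hi] with n hn using (h.chain n).le_speedSq hn.2
    · filter_upwards [hi] with n hn using (h.chain n).speedSq_le hn.1 hn.2
  have h0 := hsp (fun n => ⌊x / lam n⌋₊) (by filter_upwards [hev] with n hn; omega) hz0
  have h1 := hsp (fun n => ⌊x / lam n⌋₊ + 1) (by filter_upwards [hev] with n hn; omega) hz1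
  have := ((h0.add h1).div_const 2).const_sub 1
  rwa [add_self_div_two] at this

theorem sum_speed_defect_le {s K : ℝ} {N : ℕ} {u : ℕ → E3} (h : BoundedChain s K N u) :
    ∑ i ∈ Finset.range (N - 1), (1 - (speedSq s u i + speedSq s u (i + 1)) / 2) ^ 2 ≤
      K ^ 2 / s := by
  have hs := h.pos
  rw [le_div_iff₀ hs]
  have h1 : ∑ i ∈ Finset.range (N - 1),
      s ^ 4 * (1 - (speedSq s u i + speedSq s u (i + 1)) / 2) ^ 2 ≤ K ^ 2 * s ^ 3 := by
    refine (Finset.sum_le_sum fun i hi => ?_).trans h.energy_le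
    have hi := Finset.mem_range.mp hi
    rw [h.norm_defect_sq_eq (by omega)]
    have : 0 ≤ s ^ 2 * ‖bondChirality s u (i + 1) - bondChirality s u i‖ ^ 2 := by positivity
    linarith
  rw [← Finset.mul_sum] at h1
  have hs3 : 0 < s ^ 3 := by positivity
  refine le_of_mul_le_mul_left ?_ hs3
  linarith

/-- The squared speed defects sum to at most K²/s, so their interpolation has integral at most K²
λ/s → 0. By Fatou its lower limit vanishes almost everywhere, while at points of convergence that
lower limit is at least (1 - |z|²)². -/
theorem norm_eq_one_ae (h : ConvergentChains q K lam delta u z) : ∀ᵐ x ∂volI, ‖z x‖ = 1 := by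
  set e : ℕ → ℕ → ℝ := fun n i => 1 - (speedSq (stepScale (delta n)) (u n) i +
    speedSq (stepScale (delta n)) (u n) (i + 1)) / 2 with he
  set f : ℕ → ℝ → ℝ≥0∞ := fun n x => ∑ i ∈ Finset.range (lastIdx (lam n) - 1),
    (Set.Ico (lam n * i) (lam n * (i + 1))).indicator (fun _ => ENNReal.ofReal (e n i ^ 2)) x
    with hf
  have hmeas : ∀ n, Measurable (f n) := fun n =>
    Finset.measurable_fun_sum _ fun i _ => measurable_const.indicator measurableSet_Ico
  have hint : ∀ n, ∫⁻ x, f n x ∂volI ≤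
      ENNReal.ofReal (K ^ 2 * (lam n / stepScale (delta n))) := by
    intro n
    rw [hf]
    rw [lintegral_finsetSum _ fun i _ => measurable_const.indicator measurableSet_Ico]
    have h1 : ∀ i ∈ Finset.range (lastIdx (lam n) - 1),
        ∫⁻ x, (Set.Ico (lam n * i) (lam n * (i + 1))).indicator
          (fun _ => ENNReal.ofReal (e n i ^ 2)) x ∂volI ≤ ENNReal.ofReal (e n i ^ 2 * lam n) := by
      intro i _
      rw [lintegral_indicator_const measurableSet_Ico, ENNReal.ofReal_mul (sq_nonneg _)]
      refine mul_le_mul_right ((Measure.restrict_apply_le _ _).trans_eq ?_) _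
      rw [Real.volume_Ico]
      congr 1; ring
    refine (Finset.sum_le_sum h1).trans ?_
    rw [← ENNReal.ofReal_sum_of_nonneg fun i _ => mul_nonneg (sq_nonneg _) (h.lam_pos n).le,
      ← Finset.sum_mul]
    refine ENNReal.ofReal_le_ofReal ?_
    refine (mul_le_mul_of_nonneg_right (sum_speed_defect_le (h.chain n)) (h.lam_pos n).le).trans_eq
      ?_
    ring
  have hliminf : ∫⁻ x, liminf (fun n => f n x) atTop ∂volI = 0 := by
    refine le_antisymm ((lintegral_liminf_le hmeas).trans ?_) zero_le
    have h1 : Tendsto (fun n => ENNReal.ofReal (K ^ 2 * (lam n / stepScale (delta n)))) atTop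
        (𝓝 0) := by
      have := ENNReal.tendsto_ofReal (h.ratio_lim.const_mul (K ^ 2))
      rwa [mul_zero, ENNReal.ofReal_zero] at this
    refine (liminf_le_liminf (Eventually.of_forall hint)).trans h1.liminf_eq.le
  rw [lintegral_eq_zero_iff (Measurable.liminf hmeas)] at hliminf
  have hmem : ∀ᵐ x ∂volI, x ∈ Set.Ioo (0 : ℝ) 1 := ae_restrict_mem measurableSet_Ioo
  filter_upwards [hliminf, h.lim, hmem] with x hx0 hlim hx
  have h1 := ENNReal.tendsto_ofReal ((h.tendsto_speed_defect hx hlim).pow 2)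
  have h2 : ENNReal.ofReal ((1 - ‖z x‖ ^ 2) ^ 2) ≤ liminf (fun n => f n x) atTop := by
    rw [← h1.liminf_eq]
    refine liminf_le_liminf ?_
    filter_upwards [eventually_floor_add_le h.lam_pos h.lam_lim hx.1.le hx.2 2] with n hn
    have hl := h.lam_pos n
    have hxin : x ∈ Set.Ico (lam n * ⌊x / lam n⌋₊) (lam n * (⌊x / lam n⌋₊ + 1)) := by
      have a1 := Nat.floor_le (div_nonneg hx.1.le hl.le)
      have a2 := Nat.lt_floor_add_one (x / lam n)
      rw [le_div_iff₀ hl] at a1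
      rw [div_lt_iff₀ hl] at a2
      exact ⟨by linarith, by linarith⟩
    -- Of the whole sum only the cell containing `x` is kept.
    refine le_trans (le_of_eq ?_) (Finset.single_le_sum (fun i _ => zero_le)
      (Finset.mem_range.mpr (show ⌊x / lam n⌋₊ < lastIdx (lam n) - 1 by omega)))
    rw [Set.indicator_of_mem hxin]
  rw [hx0] at h2
  have h3 : (1 - ‖z x‖ ^ 2) ^ 2 ≤ 0 := ENNReal.ofReal_eq_zero.mp (le_antisymm h2 zero_le)
  have h4 : (1 - ‖z x‖ ^ 2) = 0 := pow_eq_zero_iff two_ne_zero |>.mp (le_antisymm h3 (sq_nonneg _))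
  have h5 : ‖z x‖ ^ 2 = 1 := by linarith
  exact (pow_eq_one_iff_of_nonneg (norm_nonneg _) two_ne_zero).mp h5

/-- A unit limit outside the closed finite set of wells would eventually stay farther from every
axis than the vanishing error in `exists_axis`. -/
theorem mem_wells_ae (hq : ∀ l, ‖q l‖ = 1) (h : ConvergentChains q K lam delta u z) :
    ∀ᵐ x ∂volI, z x ∈ wells q := by
  have hmem : ∀ᵐ x ∂volI, x ∈ Set.Ioo (0 : ℝ) 1 := ae_restrict_mem measurableSet_Ioo
  filter_upwards [h.norm_eq_one_ae, h.lim, hmem] with x hx1 hlim hx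
  have hz := h.tendsto_bondChirality hx hlim
  by_contra hcon
  have hne : ∀ p ∈ wells q, ∀ᶠ n in atTop,
      2 * (k * (2 * (K * √(stepScale (delta n))) + stepScale (delta n))) <
        ‖bondChirality (stepScale (delta n)) (u n) ⌊x / lam n⌋₊ -
          ‖bondChirality (stepScale (delta n)) (u n) ⌊x / lam n⌋₊‖ • p‖ := by
    intro p hp
    have h1 := (hz.sub (hz.norm.smul_const p)).norm
    have h2 := h.tendsto_axis_error.const_mul 2
    refine h2.eventually_lt h1 ?_
    rw [mul_zero, hx1, one_smul, norm_pos_iff, sub_ne_zero]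
    rintro rfl
    exact hcon hp
  have hall := (Filter.eventually_all_finite (finite_wells q)).mpr hne
  have hev := eventually_floor_add_le h.lam_pos h.lam_lim hx.1.le hx.2 (k + 1)
  obtain ⟨n, hn, hn'⟩ := (hall.and hev).exists
  obtain ⟨p, hp, hpn⟩ := BoundedChain.exists_axis hq (h.chain n) (h.mem n)
    (i := ⌊x / lam n⌋₊) (by omega)
  exact absurd hpn (not_le.mpr (hn p hp))

theorem eventually_transition_energy_ge (hq : ∀ l, ‖q l‖ = 1)
    (h : ConvergentChains q K lam delta u z) {ρ τ : ℝ} (hρ : 0 ≤ ρ) (hρ1 : ρ < 1) (hτ : 0 < τ)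
    {y y' : ℝ} (hyy : y < y') (hy : y ∈ Set.Ioo (0 : ℝ) 1) (hy' : y' ∈ Set.Ioo (0 : ℝ) 1)
    (hly : Tendsto (fun n => chiralityFun (lam n) (delta n) (u n) y) atTop (𝓝 (z y)))
    (hly' : Tendsto (fun n => chiralityFun (lam n) (delta n) (u n) y') atTop (𝓝 (z y')))
    (hp : z y ∈ wells q) (hp' : z y' ∈ wells q) (hpp : z y ≠ z y') :
    ∀ᶠ n in atTop, (8 / 3 * ρ ^ 3 - 4 * τ) * stepScale (delta n) ^ 3 ≤
      ∑ i ∈ Finset.Ico ⌊y / lam n⌋₊ ⌊y' / lam n⌋₊, ‖defect (stepScale (delta n)) (u n) i‖ ^ 2 := by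
  obtain ⟨m, hm0, hm⟩ := exists_pos_le_dist_of_finite (finite_wells q)
  have hz := h.tendsto_bondChirality hy hly
  have hz' := h.tendsto_bondChirality hy' hly'
  have hw := h.tendsto_axis_error
  have hK := h.tendsto_mul_sqrt
  have e1 : ∀ᶠ n in atTop, 2 * (K * √(stepScale (delta n))) + (K * √(stepScale (delta n))) ^ 2 +
      stepScale (delta n) * (1 + K) ^ 2 < 1 - ρ ^ 2 := by
    have := ((hK.const_mul 2).add (hK.pow 2)).add (h.scale_lim.mul_const ((1 + K) ^ 2))
    refine this.eventually (gt_mem_nhds ?_)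
    nlinarith
  have e2 : ∀ᶠ n in atTop, (4 * (k * (2 * (K * √(stepScale (delta n))) + stepScale (delta n))) +
      2 * (K * √(stepScale (delta n)))) / τ < m := by
    have := ((hw.const_mul 4).add (hK.const_mul 2)).div_const τ
    refine this.eventually (gt_mem_nhds ?_)
    simpa using hm0
  have e3 : ∀ᶠ n in atTop, 2 * ‖bondChirality (stepScale (delta n)) (u n) ⌊y / lam n⌋₊ - z y‖ +
      2 * ‖bondChirality (stepScale (delta n)) (u n) ⌊y' / lam n⌋₊ - z y'‖ +
      4 * (k * (2 * (K * √(stepScale (delta n))) + stepScale (delta n))) < m := by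
    have := (((hz.sub_const (z y)).norm.const_mul 2).add
      ((hz'.sub_const (z y')).norm.const_mul 2)).add (hw.const_mul 4)
    refine this.eventually (gt_mem_nhds ?_)
    simpa using hm0
  have hn1 := norm_eq_one_of_mem_wells hq hp
  have hn2 := norm_eq_one_of_mem_wells hq hp'
  have e4 := hz.norm.eventually (lt_mem_nhds (hn1.symm ▸ hρ1))
  have e5 := hz'.norm.eventually (lt_mem_nhds (hn2.symm ▸ hρ1))
  filter_upwards [e1, e2, e3, e4, e5,
    eventually_floor_add_le h.lam_pos h.lam_lim hy'.1.le hy'.2 (k + 1)] with n h1 h2 h3 h4 h5 h6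
  exact BoundedChain.transition_energy_ge hq (h.chain n) (h.mem n) hm hρ hρ1.le hτ h1.le h2
    (Nat.floor_le_floor (div_le_div_of_nonneg_right hyy.le (h.lam_pos n).le)) (by omega) hp hp' hpp
    h4.le h5.le h3

/-- Each jump has on either side two nearby points with different limit wells, hence pays for one
transition; the balls around the jumps are disjoint, so the site intervals are disjoint and the
costs add up. -/
theorem card_mul_le (hq : ∀ l, ‖q l‖ = 1) (h : ConvergentChains q K lam delta u z)
    {S : Finset ℝ} (hS : (S : Set ℝ) ⊆ jumpSet z) : 8 / 3 * (S.card : ℝ) ≤ K ^ 2 := by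
  -- The endpoints 0 and 1 are included so that the balls of radius r/2 remain inside I.
  obtain ⟨r, hr0, hr⟩ : ∃ r > 0, ∀ p ∈ (S : Set ℝ) ∪ {0, 1}, ∀ p' ∈ (S : Set ℝ) ∪ {0, 1},
      p ≠ p' → r ≤ dist p p' := exists_pos_le_dist_of_finite (S.finite_toSet.union (by simp))
  have hball : ∀ x ∈ S, Metric.ball x (r / 2) ⊆ Set.Ioo 0 1 := by
    intro x hx y hy
    have hx01 := (hS hx).1
    have h0 := hr x (Or.inl hx) 0 (by simp) hx01.1.ne'
    have h1 := hr x (Or.inl hx) 1 (by simp) hx01.2.ne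
    rw [Real.dist_eq, sub_zero, abs_of_pos hx01.1] at h0
    rw [Real.dist_eq, abs_sub_comm, abs_of_pos (by linarith [hx01.2])] at h1
    rw [Metric.mem_ball, Real.dist_eq, abs_lt] at hy
    exact ⟨by linarith, by linarith⟩
  have hex : ∀ x, ∃ y y' : ℝ, x ∈ S → y < y' ∧ y ∈ Metric.ball x (r / 2) ∧
      y' ∈ Metric.ball x (r / 2) ∧
      (Tendsto (fun n => chiralityFun (lam n) (delta n) (u n) y) atTop (𝓝 (z y)) ∧
        z y ∈ wells q) ∧
      (Tendsto (fun n => chiralityFun (lam n) (delta n) (u n) y') atTop (𝓝 (z y')) ∧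
        z y' ∈ wells q) ∧ z y ≠ z y' := by
    intro x
    by_cases hx : x ∈ S
    · obtain ⟨y, y', H⟩ := exists_ne_near_of_mem_jumpSet (hS hx) (h.lim.and (h.mem_wells_ae hq))
        (half_pos hr0) (hball x hx)
      exact ⟨y, y', fun _ => H⟩
    · exact ⟨0, 0, fun hx' => absurd hx' hx⟩
  choose y y' hyy using hex
  have main : ∀ ρ τ : ℝ, 0 ≤ ρ → ρ < 1 → 0 < τ →
      (8 / 3 * ρ ^ 3 - 4 * τ) * (S.card : ℝ) ≤ K ^ 2 := by
    intro ρ τ hρ hρ1 hτ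
    have hev : ∀ᶠ n in atTop, ∀ x ∈ S, (8 / 3 * ρ ^ 3 - 4 * τ) * stepScale (delta n) ^ 3 ≤
        ∑ i ∈ Finset.Ico ⌊y x / lam n⌋₊ ⌊y' x / lam n⌋₊,
          ‖defect (stepScale (delta n)) (u n) i‖ ^ 2 := by
      rw [Filter.eventually_all_finset]
      intro x hx
      obtain ⟨h1, h2, h3, h4, h5, h6⟩ := hyy x hx
      exact h.eventually_transition_energy_ge hq hρ hρ1 hτ h1 (hball x hx h2) (hball x hx h3)
        h4.1 h5.1 h4.2 h5.2 h6
    have hev2 : ∀ᶠ n in atTop, ∀ x ∈ S, ⌊y' x / lam n⌋₊ + 1 ≤ lastIdx (lam n) := by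
      rw [Filter.eventually_all_finset]
      intro x hx
      have := hball x hx (hyy x hx).2.2.1
      exact eventually_floor_add_le h.lam_pos h.lam_lim this.1.le this.2 1
    obtain ⟨n, hn, hn2⟩ := (hev.and hev2).exists
    have hl := h.lam_pos n
    have hdisj : (S : Set ℝ).PairwiseDisjoint
        (fun x => Finset.Ico ⌊y x / lam n⌋₊ ⌊y' x / lam n⌋₊) := by
      have aux : ∀ x ∈ S, ∀ x' ∈ S, x < x' → Disjoint (Finset.Ico ⌊y x / lam n⌋₊ ⌊y' x / lam n⌋₊)
          (Finset.Ico ⌊y x' / lam n⌋₊ ⌊y' x' / lam n⌋₊) := by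
        intro x hx x' hx' hlt
        rw [Finset.disjoint_left]
        intro i hi hi'
        rw [Finset.mem_Ico] at hi hi'
        have h1 := (hyy x hx).2.2.1
        have h2 := (hyy x' hx').2.1
        have h3 := hr x (Or.inl hx) x' (Or.inl hx') hlt.ne
        rw [Metric.mem_ball, Real.dist_eq, abs_lt] at h1 h2
        rw [Real.dist_eq, abs_sub_comm, abs_of_pos (by linarith)] at h3
        have h4 : ⌊y' x / lam n⌋₊ ≤ ⌊y x' / lam n⌋₊ :=
          Nat.floor_le_floor (div_le_div_of_nonneg_right (by linarith) hl.le)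
        omega
      intro x hx x' hx' hne
      rcases lt_or_gt_of_ne hne with hlt | hlt
      · exact aux x hx x' hx' hlt
      · exact (aux x' hx' x hx hlt).symm
    have hsub : S.biUnion (fun x => Finset.Ico ⌊y x / lam n⌋₊ ⌊y' x / lam n⌋₊) ⊆
        Finset.range (lastIdx (lam n) - 1) := by
      intro i hi
      rw [Finset.mem_biUnion] at hi
      obtain ⟨x, hx, hi⟩ := hi
      have := hn2 x hx
      rw [Finset.mem_Ico] at hi
      rw [Finset.mem_range]
      omega
    have hs3 : 0 < stepScale (delta n) ^ 3 := pow_pos (h.chain n).pos 3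
    have h1 := Finset.card_nsmul_le_sum S _ _ hn
    rw [← Finset.sum_biUnion hdisj] at h1
    have h2 := (h1.trans (Finset.sum_le_sum_of_subset_of_nonneg hsub
      fun _ _ _ => by positivity)).trans (h.chain n).energy_le
    rw [nsmul_eq_mul] at h2
    refine le_of_mul_le_mul_right ?_ hs3
    linarith
  -- The sharp constant appears on letting ρ = 1 - t and τ = t with t → 0.
  have hlim : Tendsto (fun t : ℝ => (8 / 3 * (1 - t) ^ 3 - 4 * t) * (S.card : ℝ)) (𝓝[>] 0)
      (𝓝 (8 / 3 * (S.card : ℝ))) := by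
    have : Continuous (fun t : ℝ => (8 / 3 * (1 - t) ^ 3 - 4 * t) * (S.card : ℝ)) := by fun_prop
    have h0 := this.tendsto 0
    norm_num at h0
    exact h0.mono_left nhdsWithin_le_nhds
  refine le_of_tendsto hlim ?_
  filter_upwards [Ioo_mem_nhdsGT (zero_lt_one (α := ℝ))] with t ht
  exact main (1 - t) t (by linarith [ht.2]) (by linarith [ht.1]) ht.1

theorem encard_jumpSet_le (hq : ∀ l, ‖q l‖ = 1) (h : ConvergentChains q K lam delta u z) :
    ENNReal.ofReal (8 / 3) * ((jumpSet z).encard : ℝ≥0∞) ≤ ENNReal.ofReal (K ^ 2) ∧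
      (jumpSet z).Finite := by
  have hfin : (jumpSet z).Finite := by
    by_contra hinf
    obtain ⟨n, hn⟩ := exists_nat_gt (K ^ 2)
    obtain ⟨S, hS, hcard⟩ := (Set.not_finite.mp hinf).exists_subset_card_eq n
    have := h.card_mul_le hq hS
    rw [hcard] at this
    linarith [Nat.cast_nonneg (α := ℝ) n]
  refine ⟨?_, hfin⟩
  have h1 := h.card_mul_le hq (S := hfin.toFinset) (by simp)
  rw [← hfin.encard_eq_coe_toFinset_card.symm]
  rw [show (((hfin.toFinset.card : ℕ∞) : ℝ≥0∞)) = ENNReal.ofReal (hfin.toFinset.card : ℝ) by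
    rw [ENNReal.ofReal_natCast]; rfl, ← ENNReal.ofReal_mul (by norm_num)]
  exact ENNReal.ofReal_le_ofReal h1

end ConvergentChains

/-! ### Normalisation, and the lower limit inequality by extraction of subsequences. -/

theorem energy_eq {lam delta : ℝ} (hdelta : 0 ≤ delta) (u : ℕ → E3) :
    energy lam delta u = lam / 2 * ∑ i ∈ Finset.range (lastIdx lam - 1),
      ‖defect (stepScale delta) u i‖ ^ 2 := by
  rw [energy, ← Finset.mul_sum, ← mul_assoc, one_div_mul_eq_div]
  congr 1
  refine Finset.sum_congr rfl fun i _ => ?_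
  rw [defect, stepScale, Real.sq_sqrt (by positivity), show 2 - 2 * delta = 2 * (1 - delta) by ring]

/-- Here s³ = 2√2 δ^{3/2}; the factor λ/2 is the one in `energy_eq` and cancels in the quotient. -/
theorem scaling_eq {delta : ℝ} (hdelta : 0 ≤ delta) (lam : ℝ) :
    √2 * lam * delta ^ (3 / 2 : ℝ) = lam / 2 * stepScale delta ^ 3 := by
  have h1 : delta ^ (3 / 2 : ℝ) = √delta ^ 3 := by
    rw [Real.sqrt_eq_rpow, ← Real.rpow_natCast, ← Real.rpow_mul hdelta]; norm_num
  have h2 : (√2) ^ 2 = 2 := Real.sq_sqrt (by norm_num)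
  rw [h1, stepScale, Real.sqrt_mul (by norm_num)]
  linear_combination (-(1 / 2) * √2 * lam * √delta ^ 3) * h2

/-- Extract the indices of low energy, then a subsequence converging almost everywhere. Near-minimal
spins form bounded chains with K² = C, and finiteness of the jump set yields membership in BV as
well as the bound. -/
theorem limitEnergy_le_of_frequently {k : ℕ} {q : Fin k → E3} (hq : ∀ l, ‖q l‖ = 1)
    {lam delta : ℕ → ℝ} (hlam : ∀ n, 0 < lam n) (hdelta : ∀ n, 0 < delta n)
    (hlam_lim : Tendsto lam atTop (𝓝 0))
    (hscale : Tendsto (fun n => stepScale (delta n)) atTop (𝓝 0))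
    (hratio : Tendsto (fun n => lam n / stepScale (delta n)) atTop (𝓝 0)) {z : L1I}
    {zs : ℕ → L1I} (hzs : Tendsto zs atTop (𝓝 z)) {C : ℝ} (hC : 0 ≤ C)
    (hfreq : ∃ᶠ n in atTop, chiralEnergy (lam n) (delta n) (circles q) (zs n) /
      ENNReal.ofReal (√2 * lam n * delta n ^ (3 / 2 : ℝ)) < ENNReal.ofReal C) :
    limitEnergy (wells q) z ≤ ENNReal.ofReal C := by
  have hspos : ∀ n, 0 < stepScale (delta n) := fun n =>
    Real.sqrt_pos.mpr (mul_pos two_pos (hdelta n))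
  obtain ⟨φ, hφ, hφ'⟩ := extraction_of_frequently_atTop
    (hfreq.and_eventually (hscale.eventually (gt_mem_nhds one_pos)))
  obtain ⟨ψ, hψ, hae⟩ := (tendstoInMeasure_of_tendsto_Lp
    (hzs.comp hφ.tendsto_atTop)).exists_seq_tendsto_ae
  -- Spins are chosen only along the extracted indices; elsewhere 0 stands in and is never read.
  have hex : ∀ n, ∃ u : ℕ → E3, n ∈ Set.range φ → u ∈ Configs (lam n) (circles q) ∧
      (zs n : ℝ → E3) =ᵐ[volI] chiralityFun (lam n) (delta n) u ∧
        ∑ i ∈ Finset.range (lastIdx (lam n) - 1), ‖defect (stepScale (delta n)) u i‖ ^ 2 ≤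
          C * stepScale (delta n) ^ 3 := by
    intro n
    by_cases hn : n ∈ Set.range φ
    · obtain ⟨j, rfl⟩ := hn
      have h1 := (hφ' j).1
      have hD : 0 < √2 * lam (φ j) * delta (φ j) ^ (3 / 2 : ℝ) := by
        have := hlam (φ j); have := hdelta (φ j); positivity
      rw [ENNReal.div_lt_iff (Or.inl (ENNReal.ofReal_pos.mpr hD).ne')
        (Or.inl ENNReal.ofReal_ne_top),
        ← ENNReal.ofReal_mul hC, chiralEnergy, iInf_lt_iff] at h1
      obtain ⟨u, hu⟩ := h1
      rw [iInf_lt_iff] at hu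
      obtain ⟨⟨hu1, hu2⟩, hu3⟩ := hu
      refine ⟨u, fun _ => ⟨hu1, hu2, ?_⟩⟩
      have h2 := (ENNReal.ofReal_lt_ofReal_iff_of_nonneg (by
        unfold energy
        have := hlam (φ j)
        positivity)).mp hu3
      rw [energy_eq (hdelta _).le, scaling_eq (hdelta _).le] at h2
      have hl : 0 < lam (φ j) / 2 := half_pos (hlam _)
      refine le_of_mul_le_mul_left ?_ hl
      linarith
    · exact ⟨0, fun h => absurd h hn⟩
  choose u hu using hex
  have hu' := fun j => hu (φ j) ⟨j, rfl⟩
  have hφψ : Tendsto (fun j => φ (ψ j)) atTop atTop :=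
    hφ.tendsto_atTop.comp hψ.tendsto_atTop
  have hconv : ConvergentChains q (√C) (fun j => lam (φ (ψ j))) (fun j => delta (φ (ψ j)))
      (fun j => u (φ (ψ j))) z := by
    refine ⟨fun j => hlam _, hlam_lim.comp hφψ, hscale.comp hφψ, hratio.comp hφψ, fun j => ?_,
      fun j => (hu' (ψ j)).1.1, ?_⟩
    · refine ⟨hspos _, (hφ' (ψ j)).2.le, Real.sqrt_nonneg _, fun i hi => ?_, ?_⟩
      · have := (hu' (ψ j)).1.1 i hi
        simp only [circles, Set.mem_iUnion, Set.mem_ofPred_eq] at this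
        obtain ⟨l, h, -⟩ := this
        exact h
      · rw [Real.sq_sqrt hC]; exact (hu' (ψ j)).2.2
    · have hall : ∀ᵐ x ∂volI, ∀ j, (zs (φ (ψ j)) : ℝ → E3) x =
          chiralityFun (lam (φ (ψ j))) (delta (φ (ψ j))) (u (φ (ψ j))) x :=
        ae_all_iff.mpr fun j => (hu' (ψ j)).2.1
      filter_upwards [hall, hae] with x hx hx'
      exact hx'.congr fun j => hx j
  obtain ⟨h1, h2⟩ := hconv.encard_jumpSet_le hq
  have hzQ := hconv.mem_wells_ae hq
  obtain ⟨x, p, hx0, hx1, hlt, -, hp⟩ := exists_piecewise_const (L1.integrable_coeFn z)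
    (finite_wells q) hzQ h2
  rw [limitEnergy, if_pos ⟨totalVariation_lt_top hx0 hx1 hlt hp, hzQ⟩]
  rwa [Real.sq_sqrt hC] at h1

theorem limitEnergy_le_liminf {k : ℕ} {q : Fin k → E3} (hq : ∀ l, ‖q l‖ = 1)
    {lam delta : ℕ → ℝ} (hlam : ∀ n, 0 < lam n) (hdelta : ∀ n, 0 < delta n)
    (hlam_lim : Tendsto lam atTop (𝓝 0))
    (hscale : Tendsto (fun n => stepScale (delta n)) atTop (𝓝 0))
    (hratio : Tendsto (fun n => lam n / stepScale (delta n)) atTop (𝓝 0)) {z : L1I}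
    {zs : ℕ → L1I} (hzs : Tendsto zs atTop (𝓝 z)) :
    limitEnergy (wells q) z ≤ liminf (fun n => chiralEnergy (lam n) (delta n) (circles q) (zs n) /
      ENNReal.ofReal (√2 * lam n * delta n ^ (3 / 2 : ℝ))) atTop := by
  refine le_of_forall_gt fun c hc => ?_
  -- The intermediate value is finite and gives a strict bound for infinitely many indices.
  obtain ⟨c', hc1, hc2⟩ := exists_between hc
  refine lt_of_le_of_lt ?_ hc2
  have hne : c' ≠ ∞ := (hc2.trans_le le_top).ne
  have hfreq := frequently_lt_of_liminf_lt (by isBoundedDefault) hc1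
  rw [← ENNReal.ofReal_toReal hne] at hfreq ⊢
  exact limitEnergy_le_of_frequently hq hlam hdelta hlam_lim hscale hratio hzs
    ENNReal.toReal_nonneg hfreq

/-! ### The optimal profile -/

theorem hasDerivAt_tanh (t : ℝ) : HasDerivAt Real.tanh (1 - Real.tanh t ^ 2) t := by
  have h := (Real.hasDerivAt_sinh t).div (Real.hasDerivAt_cosh t) (Real.cosh_pos t).ne'
  have heq : Real.tanh = Real.sinh / Real.cosh := by
    ext x; rw [Pi.div_apply, Real.tanh_eq_sinh_div_cosh]
  rw [heq]
  refine h.congr_deriv ?_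
  rw [Pi.div_apply]
  have := (Real.cosh_pos t).ne'
  field_simp

theorem continuous_tanh : Continuous Real.tanh :=
  continuous_iff_continuousAt.mpr fun t => (hasDerivAt_tanh t).continuousAt

theorem tanh_sq_lt_one (t : ℝ) : Real.tanh t ^ 2 < 1 :=
  (sq_lt_one_iff_abs_lt_one _).mpr (Real.abs_tanh_lt_one t)

theorem monotone_tanh : Monotone Real.tanh :=
  monotone_of_deriv_nonneg (fun t => (hasDerivAt_tanh t).differentiableAt) fun t => by
    rw [(hasDerivAt_tanh t).deriv]; linarith [tanh_sq_lt_one t]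

theorem tendsto_tanh_atTop : Tendsto Real.tanh atTop (𝓝 1) := by
  have h1 : Tendsto (fun t : ℝ => 1 - 2 * Real.exp (-t)) atTop (𝓝 1) := by
    have := (Real.tendsto_exp_neg_atTop_nhds_zero.const_mul 2).const_sub 1
    simpa using this
  refine tendsto_of_tendsto_of_tendsto_of_le_of_le' h1 tendsto_const_nhds ?_
    (Eventually.of_forall fun t => (Real.tanh_lt_one t).le)
  filter_upwards [eventually_ge_atTop 0] with t ht
  have ha : 1 ≤ Real.exp t := Real.one_le_exp ht
  have hb : 0 < Real.exp (-t) := Real.exp_pos _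
  rw [Real.tanh_eq, le_div_iff₀ (by linarith)]
  nlinarith

theorem tanh_pos {t : ℝ} (ht : 0 < t) : 0 < Real.tanh t := by
  rw [Real.tanh_eq_sinh_div_cosh]
  exact div_pos (Real.sinh_pos_iff.mpr ht) (Real.cosh_pos t)

/-- A primitive is y - y³/3 with y = tanh t, which stays between -2/3 and 2/3. -/
theorem integral_one_sub_tanh_sq_sq_le (a b : ℝ) :
    ∫ t in a..b, (1 - Real.tanh t ^ 2) ^ 2 ≤ 4 / 3 := by
  have hd : ∀ t, HasDerivAt (fun t => Real.tanh t - Real.tanh t ^ 3 / 3)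
      ((1 - Real.tanh t ^ 2) ^ 2) t := by
    intro t
    have h := (hasDerivAt_tanh t).sub (((hasDerivAt_tanh t).pow 3).div_const 3)
    refine h.congr_deriv ?_
    push_cast
    ring
  have hc : Continuous fun t => (1 - Real.tanh t ^ 2) ^ 2 :=
    (continuous_const.sub (continuous_tanh.pow 2)).pow 2
  rw [intervalIntegral.integral_eq_sub_of_hasDerivAt (fun t _ => hd t) (hc.intervalIntegrable _ _)]
  have hb : ∀ y : ℝ, -1 < y → y < 1 → y - y ^ 3 / 3 ≤ 2 / 3 ∧ -(2 / 3) ≤ y - y ^ 3 / 3 := by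
    -- The bounds come from 2 - 3y + y³ = (1 - y)² (y + 2) and its reflection.
    intro y h1 h2
    have a1 := mul_nonneg (sq_nonneg (1 - y)) (show 0 ≤ y + 2 by linarith)
    have a2 := mul_nonneg (sq_nonneg (1 + y)) (show 0 ≤ 2 - y by linarith)
    constructor <;> linarith
  have h1 := (hb _ (Real.neg_one_lt_tanh b) (Real.tanh_lt_one b)).1
  have h2 := (hb _ (Real.neg_one_lt_tanh a) (Real.tanh_lt_one a)).2
  linarith

/-- The speed of the transition of half-width `T`. -/
noncomputable def profileSpeed (T t : ℝ) : ℝ := min 1 (|Real.tanh t| / Real.tanh T)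

theorem continuous_profileSpeed (T : ℝ) : Continuous (profileSpeed T) :=
  continuous_const.min (continuous_tanh.abs.div_const _)

theorem profileSpeed_zero (T : ℝ) : profileSpeed T 0 = 0 := by
  simp [profileSpeed]

theorem profileSpeed_neg (T t : ℝ) : profileSpeed T (-t) = profileSpeed T t := by
  simp [profileSpeed, Real.tanh_neg]

theorem profileSpeed_of_ge {T t : ℝ} (hT : 0 < T) (ht : T ≤ t) : profileSpeed T t = 1 := by
  refine min_eq_left ?_
  rw [le_div_iff₀ (tanh_pos hT), one_mul]
  exact (monotone_tanh ht).trans (le_abs_self _)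

theorem profileSpeed_of_nonneg {T t : ℝ} (hT : 0 < T) (h0 : 0 ≤ t) (ht : t ≤ T) :
    profileSpeed T t = Real.tanh t / Real.tanh T := by
  have h : 0 ≤ Real.tanh t := by have := monotone_tanh h0; rwa [Real.tanh_zero] at this
  rw [profileSpeed, abs_of_nonneg h]
  refine min_eq_right ?_
  rw [div_le_one (tanh_pos hT)]
  exact monotone_tanh ht

theorem profileSpeed_nonneg {T : ℝ} (hT : 0 < T) (t : ℝ) : 0 ≤ profileSpeed T t :=
  le_min zero_le_one (div_nonneg (abs_nonneg _) (tanh_pos hT).le)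

theorem profileSpeed_le_one (T t : ℝ) : profileSpeed T t ≤ 1 := min_le_left _ _

/-- Dividing by tanh T < 1 only increases the speed towards 1, so the potential term does not grow;
the price is the factor 1/tanh T in the derivative. -/
theorem abs_one_sub_profileSpeed_sq_le {T : ℝ} (hT : 0 < T) (t : ℝ) :
    |1 - profileSpeed T t ^ 2| ≤ 1 - Real.tanh t ^ 2 := by
  have h0 := profileSpeed_nonneg hT t
  have h1 := profileSpeed_le_one T t
  have h2 : |Real.tanh t| ≤ profileSpeed T t :=
    le_min (Real.abs_tanh_lt_one t).le
      (le_div_self (abs_nonneg _) (tanh_pos hT) (Real.tanh_lt_one T).le)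
  rw [abs_of_nonneg (by nlinarith), ← sq_abs (Real.tanh t)]
  have := pow_le_pow_left₀ (abs_nonneg _) h2 2
  linarith

/-- The profile has corners at 0 and ±T, so only right derivatives are used. -/
theorem exists_hasDerivWithinAt_profileSpeed {T : ℝ} (hT : 0 < T) (t : ℝ) :
    ∃ w, HasDerivWithinAt (profileSpeed T) w (Set.Ici t) t ∧
      |w| ≤ (1 - Real.tanh t ^ 2) / Real.tanh T := by
  have hc := tanh_pos hT
  have hnn : 0 ≤ (1 - Real.tanh t ^ 2) / Real.tanh T :=
    div_nonneg (by linarith [tanh_sq_lt_one t]) hc.le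
  have hpos : HasDerivAt (fun y => Real.tanh y / Real.tanh T)
      ((1 - Real.tanh t ^ 2) / Real.tanh T) t := (hasDerivAt_tanh t).div_const _
  have hneg : HasDerivAt (fun y => -Real.tanh y / Real.tanh T)
      (-(1 - Real.tanh t ^ 2) / Real.tanh T) t := (hasDerivAt_tanh t).neg.div_const _
  have hnegs : ∀ y, -T ≤ y → y ≤ 0 → profileSpeed T y = -Real.tanh y / Real.tanh T := by
    intro y h1 h2
    rw [← profileSpeed_neg, profileSpeed_of_nonneg hT (by linarith) (by linarith), Real.tanh_neg]
  have hout : ∀ y, y ≤ -T → profileSpeed T y = 1 := by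
    intro y hy
    rw [← profileSpeed_neg, profileSpeed_of_ge hT (by linarith)]
  have hIco : ∀ b, t < b → Set.Ico t b ∈ 𝓝[≥] t := fun b hb => Ico_mem_nhdsGE hb
  rcases lt_or_ge t (-T) with h1 | h1
  · refine ⟨0, ((hasDerivWithinAt_const t (Set.Ici t) (1 : ℝ))).congr_of_eventuallyEq ?_
      (hout t h1.le), by simpa using hnn⟩
    filter_upwards [hIco _ h1] with y hy using hout y hy.2.le
  rcases lt_or_ge t 0 with h2 | h2
  · refine ⟨_, hneg.hasDerivWithinAt.congr_of_eventuallyEq ?_ (hnegs t h1 h2.le), ?_⟩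
    · filter_upwards [hIco _ h2] with y hy using hnegs y (h1.trans hy.1) hy.2.le
    · rw [neg_div, abs_neg, abs_of_nonneg hnn]
  rcases lt_or_ge t T with h3 | h3
  · refine ⟨_, hpos.hasDerivWithinAt.congr_of_eventuallyEq ?_ (profileSpeed_of_nonneg hT h2 h3.le),
      (abs_of_nonneg hnn).le⟩
    filter_upwards [hIco _ h3] with y hy using
      profileSpeed_of_nonneg hT (h2.trans hy.1) hy.2.le
  · refine ⟨0, ((hasDerivWithinAt_const t (Set.Ici t) (1 : ℝ))).congr (fun y hy => ?_)
      (profileSpeed_of_ge hT h3), by simpa using hnn⟩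
    exact profileSpeed_of_ge hT (h3.trans hy)

/-- The angle swept by the transition profile. -/
noncomputable def profileAngle (T t : ℝ) : ℝ := ∫ x in (0 : ℝ)..t, profileSpeed T x

theorem hasDerivAt_profileAngle (T t : ℝ) :
    HasDerivAt (profileAngle T) (profileSpeed T t) t :=
  intervalIntegral.integral_hasDerivAt_right ((continuous_profileSpeed T).intervalIntegrable _ _)
    ((continuous_profileSpeed T).stronglyMeasurableAtFilter _ _)
    (continuous_profileSpeed T).continuousAt

theorem profileAngle_zero (T : ℝ) : profileAngle T 0 = 0 := by simp [profileAngle]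

theorem profileAngle_neg (T t : ℝ) : profileAngle T (-t) = -profileAngle T t := by
  have h := intervalIntegral.integral_comp_neg (a := 0) (b := t) (profileSpeed T)
  simp only [profileSpeed_neg, neg_zero] at h
  rw [profileAngle, profileAngle, h, ← intervalIntegral.integral_symm]

/-- Past the transition the motion is uniform, with the constant phase lag T - `profileAngle T T`
caused by slowing down. -/
theorem profileAngle_of_ge {T t : ℝ} (hT : 0 < T) (ht : T ≤ t) :
    profileAngle T t = t - (T - profileAngle T T) := by
  have hi := fun a b => (continuous_profileSpeed T).intervalIntegrable (μ := volume) a b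
  have h1 : ∫ x in T..t, profileSpeed T x = ∫ x in T..t, (1 : ℝ) := by
    refine intervalIntegral.integral_congr fun x hx => ?_
    rw [Set.uIcc_of_le ht] at hx
    exact profileSpeed_of_ge hT hx.1
  have h2 := intervalIntegral.integral_add_adjacent_intervals (hi 0 T) (hi T t)
  rw [h1, intervalIntegral.integral_const, smul_eq_mul, mul_one] at h2
  unfold profileAngle
  linarith

theorem profileAngle_of_le {T t : ℝ} (hT : 0 < T) (ht : t ≤ -T) :
    profileAngle T t = t + (T - profileAngle T T) := by
  have h := profileAngle_of_ge hT (show T ≤ -t by linarith)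
  rw [profileAngle_neg] at h
  linarith

/-! ### Great circles -/

/-- The point reached from `P` after travelling the angle `t` around the axis `p`. -/
noncomputable def arc (p P : E3) (t : ℝ) : E3 := Real.cos t • P + Real.sin t • cross p P

theorem continuous_arc (p P : E3) : Continuous (arc p P) := by
  unfold arc; fun_prop

theorem arc_zero (p P : E3) : arc p P 0 = P := by simp [arc]

theorem arc_periodic (p P : E3) (t : ℝ) (n : ℤ) : arc p P (t - n * (2 * Real.pi)) = arc p P t := by
  rw [arc, Real.cos_sub_int_mul_two_pi, Real.sin_sub_int_mul_two_pi, arc]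

theorem arc_add_pi_div_two (p P : E3) (t : ℝ) :
    arc p P (t + Real.pi / 2) = -Real.sin t • P + Real.cos t • cross p P := by
  rw [arc, Real.cos_add_pi_div_two, Real.sin_add_pi_div_two]

theorem arc_add_pi (p P : E3) (t : ℝ) : arc p P (t + Real.pi / 2 + Real.pi / 2) = -arc p P t := by
  rw [arc_add_pi_div_two, Real.sin_add_pi_div_two, Real.cos_add_pi_div_two, arc]
  module

theorem hasDerivAt_arc (p P : E3) (t : ℝ) : HasDerivAt (arc p P) (arc p P (t + Real.pi / 2)) t := by
  rw [arc_add_pi_div_two]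
  exact ((Real.hasDerivAt_cos t).smul_const P).add ((Real.hasDerivAt_sin t).smul_const (cross p P))

theorem arc_arc {p P : E3} (hp : ‖p‖ = 1) (hpP : inner ℝ p P = 0) (a t : ℝ) :
    arc p (arc p P a) t = arc p P (a + t) := by
  have h1 : cross p (cross p P) = -P := by
    have := eq_inner_smul_sub_cross_cross hp P
    rw [hpP, zero_smul, zero_sub] at this
    rw [eq_neg_iff_add_eq_zero]
    nth_rw 2 [this]
    simp
  simp only [arc, cross_add_right, cross_smul_right, h1, Real.cos_add, Real.sin_add]
  module

theorem cross_arc_arc {p P : E3} (hP : ‖P‖ = 1) (hpP : inner ℝ p P = 0) (a t : ℝ) :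
    cross (arc p P a) (arc p P t) = Real.sin (t - a) • p := by
  have h1 : cross P (cross p P) = p := by
    have := eq_inner_smul_sub_cross_cross hP p
    rw [real_inner_comm, hpP, zero_smul, zero_sub, ← neg_eq_iff_eq_neg] at this
    rw [cross_anticomm' P p, ← neg_one_smul ℝ (cross P p), cross_smul_right, neg_one_smul, ← this,
      neg_neg]
  have h2 : cross (cross p P) P = -p := by rw [cross_anticomm', h1]
  have h3 : cross (arc p P a) P = -Real.sin a • p := by
    rw [cross_anticomm', arc, cross_add_right, cross_smul_right, cross_smul_right, cross_self', h1]
    module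
  have h4 : cross (arc p P a) (cross p P) = Real.cos a • p := by
    rw [cross_anticomm', arc, cross_add_right, cross_smul_right, cross_smul_right, cross_self', h2]
    module
  rw [arc.eq_1 p P t, cross_add_right, cross_smul_right, cross_smul_right, h3, h4, Real.sin_sub]
  module

section Frame

variable {p P : E3} (hp : ‖p‖ = 1) (hP : ‖P‖ = 1) (hpP : inner ℝ p P = 0)
include hp hP hpP

theorem norm_cross_eq_one : ‖cross p P‖ = 1 := by
  have h := norm_cross_sq p P
  rw [hp, hP, hpP] at h
  exact (pow_eq_one_iff_of_nonneg (norm_nonneg _) two_ne_zero).mp (by linarith)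

theorem norm_combination_sq (a b : ℝ) : ‖a • P + b • cross p P‖ ^ 2 = a ^ 2 + b ^ 2 := by
  rw [norm_add_sq_real, norm_smul, norm_smul, norm_cross_eq_one hp hP hpP, hP, inner_smul_left,
    inner_smul_right, inner_cross_right_self, Real.norm_eq_abs, Real.norm_eq_abs, mul_one, mul_one,
    sq_abs, sq_abs]
  simp

theorem norm_arc (t : ℝ) : ‖arc p P t‖ = 1 := by
  have h := norm_combination_sq hp hP hpP (Real.cos t) (Real.sin t)
  rw [Real.cos_sq_add_sin_sq] at h
  exact (pow_eq_one_iff_of_nonneg (norm_nonneg _) two_ne_zero).mp h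

theorem norm_arc_combination_sq (t a b : ℝ) :
    ‖a • arc p P (t + Real.pi / 2) + b • arc p P t‖ ^ 2 = a ^ 2 + b ^ 2 := by
  have h := norm_combination_sq hp hP hpP (-a * Real.sin t + b * Real.cos t)
    (a * Real.cos t + b * Real.sin t)
  have h2 : a • arc p P (t + Real.pi / 2) + b • arc p P t =
      (-a * Real.sin t + b * Real.cos t) • P + (a * Real.cos t + b * Real.sin t) • cross p P := by
    rw [arc_add_pi_div_two, arc]; module
  rw [h2, h]
  linear_combination (a ^ 2 + b ^ 2) * Real.sin_sq_add_cos_sq t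

end Frame

theorem inner_arc {p P : E3} (hpP : inner ℝ p P = 0) (t : ℝ) : inner ℝ p (arc p P t) = 0 := by
  rw [arc, inner_add_right, inner_smul_right, inner_smul_right, hpP, inner_cross_left_self]
  simp

/-- In the orthonormal frame P, p × P of the plane orthogonal to p, the angle is the argument of a
unit complex number. -/
theorem exists_arc_eq {p P P' : E3} (hp : ‖p‖ = 1) (hP : ‖P‖ = 1) (hpP : inner ℝ p P = 0)
    (hP' : ‖P'‖ = 1) (hpP' : inner ℝ p P' = 0) : ∃ a, P' = arc p P a := by
  have h1 := eq_inner_smul_sub_cross_cross hP P'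
  rw [cross_eq_smul_of_orthogonal hp hpP hpP', cross_smul_right, cross_anticomm' p P, smul_neg,
    sub_neg_eq_add] at h1
  set x : ℝ := inner ℝ P P'
  set y : ℝ := inner ℝ p (cross P P')
  have h2 : x ^ 2 + y ^ 2 = 1 := by
    rw [← norm_combination_sq hp hP hpP, ← h1, hP', one_pow]
  have hn : ‖(⟨x, y⟩ : ℂ)‖ = 1 := by
    refine (pow_eq_one_iff_of_nonneg (norm_nonneg _) two_ne_zero).mp ?_
    rw [← Complex.normSq_eq_norm_sq, Complex.normSq_mk]; linarith
  have hne : (⟨x, y⟩ : ℂ) ≠ 0 := norm_ne_zero_iff.mp (by rw [hn]; exact one_ne_zero)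
  refine ⟨Complex.arg ⟨x, y⟩, ?_⟩
  rw [arc, Complex.cos_arg hne, Complex.sin_arg, hn, div_one, div_one]
  exact h1

/-! ### Second differences of curves -/

/-- The second difference `U(t + 2α) - 2 cos α U(t + α) + U(t)`, which vanishes for unit speed
motion along great circles. -/
noncomputable def curveDefect (α : ℝ) (U : ℝ → E3) (t : ℝ) : E3 :=
  U (t + 2 * α) - (2 * Real.cos α) • U (t + α) + U t

theorem curveDefect_arc (p P : E3) (α t : ℝ) : curveDefect α (arc p P) t = 0 := by
  have h1 : Real.cos (t + 2 * α) + Real.cos t = 2 * Real.cos α * Real.cos (t + α) := by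
    rw [show t + 2 * α = (t + α) + α by ring, show Real.cos t = Real.cos ((t + α) - α) by ring_nf,
      Real.cos_add (t + α), Real.cos_sub]; ring
  have h2 : Real.sin (t + 2 * α) + Real.sin t = 2 * Real.cos α * Real.sin (t + α) := by
    rw [show t + 2 * α = (t + α) + α by ring, show Real.sin t = Real.sin ((t + α) - α) by ring_nf,
      Real.sin_add (t + α), Real.sin_sub]; ring
  have h3 : curveDefect α (arc p P) t =
      (Real.cos (t + 2 * α) + Real.cos t - 2 * Real.cos α * Real.cos (t + α)) • P +
      (Real.sin (t + 2 * α) + Real.sin t - 2 * Real.cos α * Real.sin (t + α)) • cross p P := by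
    simp only [curveDefect, arc]; module
  rw [h3, h1, h2]; simp

theorem norm_sub_le_integral_of_right_deriv {f f' : ℝ → E3} {g : ℝ → ℝ} {a b : ℝ} (hab : a ≤ b)
    (hf : Continuous f) (hf' : ∀ x, HasDerivWithinAt f (f' x) (Set.Ici x) x) (hg : Continuous g)
    (hfg : ∀ x ∈ Set.Ico a b, ‖f' x‖ ≤ g x) : ‖f b - f a‖ ≤ ∫ x in a..b, g x := by
  have hG : ∀ x, HasDerivAt (fun y => ∫ t in a..y, g t) (g x) x := fun x =>
    intervalIntegral.integral_hasDerivAt_right (hg.intervalIntegrable _ _)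
      (hg.stronglyMeasurableAtFilter _ _) hg.continuousAt
  exact image_norm_le_of_norm_deriv_right_le_deriv_boundary' (f := fun x => f x - f a)
    (B := fun y => ∫ t in a..y, g t)
    (hf.sub continuous_const).continuousOn (fun x _ => (hf' x).sub_const (f a)) (by simp)
    (continuous_iff_continuousAt.mpr fun x => (hG x).continuousAt).continuousOn
    (fun x _ => (hG x).hasDerivWithinAt) hfg ⟨hab, le_rfl⟩

/-- Weighted Cauchy–Schwarz: the quadratic r ↦ ∫ w (g - r)² is nonnegative, so its discriminant is
not positive. -/
theorem sq_integral_mul_le {w g : ℝ → ℝ} {a b : ℝ} (hab : a ≤ b) (hw : Continuous w)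
    (hg : Continuous g) (hw0 : ∀ x ∈ Set.Icc a b, 0 ≤ w x) :
    (∫ x in a..b, w x * g x) ^ 2 ≤ (∫ x in a..b, w x) * ∫ x in a..b, w x * g x ^ 2 := by
  have hq : ∀ r : ℝ, 0 ≤ (∫ x in a..b, w x) * (r * r) + (-2 * ∫ x in a..b, w x * g x) * r +
      ∫ x in a..b, w x * g x ^ 2 := by
    intro r
    have h1 : 0 ≤ ∫ x in a..b, w x * (g x - r) ^ 2 :=
      intervalIntegral.integral_nonneg hab fun x hx => mul_nonneg (hw0 x hx) (sq_nonneg _)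
    have h2 : ∫ x in a..b, w x * (g x - r) ^ 2 = (∫ x in a..b, (r * r) * w x) +
        (∫ x in a..b, (-2 * r) * (w x * g x)) + ∫ x in a..b, w x * g x ^ 2 := by
      rw [← intervalIntegral.integral_add, ← intervalIntegral.integral_add]
      · refine intervalIntegral.integral_congr fun x _ => ?_
        ring
      all_goals exact Continuous.intervalIntegrable (by fun_prop) _ _
    rw [h2, intervalIntegral.integral_const_mul, intervalIntegral.integral_const_mul] at h1
    linarith
  have h := discrim_le_zero hq
  rw [discrim] at h
  linarith

theorem sum_add_succ_le {A B : ℕ → ℝ} (hA : ∀ i, 0 ≤ A i) (hB : ∀ i, 0 ≤ B i) (N : ℕ) :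
    ∑ i ∈ Finset.range N, (A i + B (i + 1)) ≤ ∑ i ∈ Finset.range (N + 1), (A i + B i) := by
  rw [Finset.sum_add_distrib, Finset.sum_add_distrib, Finset.sum_range_succ A,
    Finset.sum_range_succ' B]
  linarith [hA N, hB 0]

section Sampling

variable {V V1 V2 : ℝ → E3} {g : ℝ → ℝ} {b α : ℝ} (hV : Continuous V) (hV1 : Continuous V1)
  (hd : ∀ x, HasDerivWithinAt V (V1 x) (Set.Ici x) x)
  (hd1 : ∀ x, HasDerivWithinAt V1 (V2 x) (Set.Ici x) x) (hg : Continuous g)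
  (hb : ∀ x, ‖V2 x + V x‖ ≤ b * g x) (hα : 0 < α) (hα1 : α ≤ 1)
include hV hV1 hd hd1 hg hb hα hα1

/-- Variation of constants for V'' + V: the combination sin(x - t) V' - cos(x - t) V has right
derivative sin(x - t)(V'' + V). With its mirror image on the next cell, the boundary terms add up
exactly to the second difference. -/
theorem norm_curveDefect_le (t : ℝ) :
    ‖curveDefect α V t‖ ≤ b * ((∫ x in t..(t + α), Real.sin (x - t) * g x) +
      ∫ x in (t + α)..(t + α + α), Real.sin (t + α + α - x) * g x) := by
  have hπ := Real.pi_gt_three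
  have hs1 : ∀ x, HasDerivAt (fun x => Real.sin (x - t)) (Real.cos (x - t)) x := fun x => by
    simpa using ((hasDerivAt_id x).sub_const t).sin
  have hc1 : ∀ x, HasDerivAt (fun x => Real.cos (x - t)) (-Real.sin (x - t)) x := fun x => by
    simpa using ((hasDerivAt_id x).sub_const t).cos
  have hs2 : ∀ x, HasDerivAt (fun x => Real.sin (t + α + α - x)) (-Real.cos (t + α + α - x)) x :=
    fun x => by simpa using ((hasDerivAt_id x).const_sub (t + α + α)).sin
  have hc2 : ∀ x, HasDerivAt (fun x => Real.cos (t + α + α - x)) (Real.sin (t + α + α - x)) x :=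
    fun x => by simpa using ((hasDerivAt_id x).const_sub (t + α + α)).cos
  have e1 := norm_sub_le_integral_of_right_deriv (a := t) (b := t + α)
    (f := fun x => Real.sin (x - t) • V1 x - Real.cos (x - t) • V x)
    (f' := fun x => Real.sin (x - t) • (V2 x + V x)) (g := fun x => b * (Real.sin (x - t) * g x))
    (by linarith) (by fun_prop) (fun x => by
      have h1 := ((hs1 x).hasDerivWithinAt.smul (hd1 x)).sub
        ((hc1 x).hasDerivWithinAt.smul (hd x))
      refine h1.congr_deriv ?_
      module) (by fun_prop) (fun x hx => by
      have hs : 0 ≤ Real.sin (x - t) :=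
        Real.sin_nonneg_of_nonneg_of_le_pi (by linarith [hx.1]) (by linarith [hx.2])
      rw [norm_smul, Real.norm_of_nonneg hs]
      have := mul_le_mul_of_nonneg_left (hb x) hs
      linarith)
  have e2 := norm_sub_le_integral_of_right_deriv (a := t + α) (b := t + α + α)
    (f := fun x => Real.sin (t + α + α - x) • V1 x + Real.cos (t + α + α - x) • V x)
    (f' := fun x => Real.sin (t + α + α - x) • (V2 x + V x))
    (g := fun x => b * (Real.sin (t + α + α - x) * g x))
    (by linarith) (by fun_prop) (fun x => by
      have h1 := ((hs2 x).hasDerivWithinAt.smul (hd1 x)).add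
        ((hc2 x).hasDerivWithinAt.smul (hd x))
      refine h1.congr_deriv ?_
      module) (by fun_prop) (fun x hx => by
      have hs : 0 ≤ Real.sin (t + α + α - x) :=
        Real.sin_nonneg_of_nonneg_of_le_pi (by linarith [hx.2]) (by linarith [hx.1])
      rw [norm_smul, Real.norm_of_nonneg hs]
      have := mul_le_mul_of_nonneg_left (hb x) hs
      linarith)
  rw [intervalIntegral.integral_const_mul] at e1 e2
  simp only [sub_self, Real.sin_zero, Real.cos_zero, add_sub_cancel_left] at e1 e2
  have h3 : curveDefect α V t =
      (Real.sin α • V1 (t + α) - Real.cos α • V (t + α) - ((0 : ℝ) • V1 t - (1 : ℝ) • V t)) +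
      ((0 : ℝ) • V1 (t + α + α) + (1 : ℝ) • V (t + α + α) -
        (Real.sin α • V1 (t + α) + Real.cos α • V (t + α))) := by
    rw [curveDefect, show t + 2 * α = t + α + α by ring]; module
  rw [h3, mul_add]
  exact (norm_add_le _ _).trans (add_le_add e1 e2)

/-- The kernel has mass 1 - cos α = s²/2 on each cell, so Cauchy–Schwarz costs no error term. After
summation each cell carries a rising and a falling sine, whose sum is at most s; the total is s³
times the continuum energy. -/
theorem sum_norm_curveDefect_sq_le (hg2 : ∀ a c, ∫ x in a..c, g x ^ 2 ≤ 4 / 3) (t : ℝ) (N : ℕ) :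
    ∑ i ∈ Finset.range N, ‖curveDefect α V (t + i * α)‖ ^ 2 ≤
      b ^ 2 * (4 / 3) * (2 * Real.sin (α / 2)) ^ 3 := by
  have hπ := Real.pi_gt_three
  set s := 2 * Real.sin (α / 2) with hs
  have hs0 : 0 ≤ s := by
    have := Real.sin_nonneg_of_nonneg_of_le_pi (x := α / 2) (by linarith) (by linarith)
    positivity
  have hs2 : 1 - Real.cos α = s ^ 2 / 2 := by
    have h1 := Real.cos_sq' (α / 2)
    have h2 := Real.cos_two_mul (α / 2)
    rw [show 2 * (α / 2) = α by ring] at h2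
    rw [hs, h2]; linear_combination (-2) * h1
  set a : ℕ → ℝ := fun i => t + i * α with ha
  have hasucc : ∀ i, a (i + 1) = a i + α := fun i => by simp only [ha]; push_cast; ring
  set A : ℕ → ℝ := fun i => ∫ x in a i..a (i + 1), Real.sin (x - a i) * g x ^ 2 with hA
  set B : ℕ → ℝ := fun i => ∫ x in a i..a (i + 1), Real.sin (a (i + 1) - x) * g x ^ 2 with hB
  have hle : ∀ i, a i ≤ a (i + 1) := fun i => by rw [hasucc]; linarith
  have hsin1 : ∀ i, ∀ x ∈ Set.Icc (a i) (a (i + 1)), 0 ≤ Real.sin (x - a i) := fun i x hx => by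
    rw [hasucc] at hx
    exact Real.sin_nonneg_of_nonneg_of_le_pi (by linarith [hx.1]) (by linarith [hx.2])
  have hsin2 : ∀ i, ∀ x ∈ Set.Icc (a i) (a (i + 1)), 0 ≤ Real.sin (a (i + 1) - x) :=
    fun i x hx => by
    rw [hasucc] at hx ⊢
    exact Real.sin_nonneg_of_nonneg_of_le_pi (by linarith [hx.2]) (by linarith [hx.1])
  have hA0 : ∀ i, 0 ≤ A i := fun i => intervalIntegral.integral_nonneg (hle i) fun x hx =>
    mul_nonneg (hsin1 i x hx) (sq_nonneg _)
  have hB0 : ∀ i, 0 ≤ B i := fun i => intervalIntegral.integral_nonneg (hle i) fun x hx =>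
    mul_nonneg (hsin2 i x hx) (sq_nonneg _)
  have hw1 : ∀ i, ∫ x in a i..a (i + 1), Real.sin (x - a i) = s ^ 2 / 2 := by
    intro i
    rw [intervalIntegral.integral_comp_sub_right (fun x => Real.sin x), integral_sin, sub_self,
      hasucc, add_sub_cancel_left, Real.cos_zero, hs2]
  have hw2 : ∀ i, ∫ x in a i..a (i + 1), Real.sin (a (i + 1) - x) = s ^ 2 / 2 := by
    intro i
    rw [intervalIntegral.integral_comp_sub_left (fun x => Real.sin x), integral_sin, sub_self,
      hasucc, add_sub_cancel_left, Real.cos_zero, hs2]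
  have hterm : ∀ i, ‖curveDefect α V (a i)‖ ^ 2 ≤ b ^ 2 * s ^ 2 * (A i + B (i + 1)) := by
    intro i
    have h1 := norm_curveDefect_le hV hV1 hd hd1 hg hb hα hα1 (a i)
    rw [← hasucc, ← hasucc] at h1
    have h2 := pow_le_pow_left₀ (norm_nonneg _) h1 2
    have h3 := sq_integral_mul_le (hle i) (w := fun x => Real.sin (x - a i)) (by fun_prop) hg
      (hsin1 i)
    have h4 := sq_integral_mul_le (hle (i + 1)) (w := fun x => Real.sin (a (i + 1 + 1) - x))
      (by fun_prop) hg (hsin2 (i + 1))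
    rw [hw1] at h3
    rw [hw2] at h4
    refine h2.trans ?_
    rw [mul_pow, mul_assoc]
    refine mul_le_mul_of_nonneg_left ?_ (sq_nonneg b)
    refine (add_sq_le).trans ?_
    simp only [hA, hB]
    linarith
  have hAB : ∀ i, A i + B i ≤ s * ∫ x in a i..a (i + 1), g x ^ 2 := by
    intro i
    rw [← intervalIntegral.integral_const_mul, ← intervalIntegral.integral_add
      (Continuous.intervalIntegrable (by fun_prop) _ _)
      (Continuous.intervalIntegrable (by fun_prop) _ _)]
    refine intervalIntegral.integral_mono_on (hle i)
      (Continuous.intervalIntegrable (by fun_prop) _ _)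
      (Continuous.intervalIntegrable (by fun_prop) _ _) fun x _ => ?_
    rw [← add_mul]
    refine mul_le_mul_of_nonneg_right ?_ (sq_nonneg _)
    -- Sum to product about the midpoint of the cell, where the cosine is largest.
    have h1 : Real.sin (x - a i) + Real.sin (a (i + 1) - x) =
        2 * Real.sin (α / 2) * Real.cos (x - a i - α / 2) := by
      obtain ⟨c, hc⟩ : ∃ c, c = x - a i - α / 2 := ⟨_, rfl⟩
      rw [← hc, hasucc, show a i + α - x = α / 2 - c by rw [hc]; ring,
        show x - a i = α / 2 + c by rw [hc]; ring, Real.sin_add, Real.sin_sub]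
      ring
    rw [h1]
    exact mul_le_of_le_one_right hs0 (Real.cos_le_one _)
  calc ∑ i ∈ Finset.range N, ‖curveDefect α V (a i)‖ ^ 2
      ≤ ∑ i ∈ Finset.range N, b ^ 2 * s ^ 2 * (A i + B (i + 1)) :=
        Finset.sum_le_sum fun i _ => hterm i
    _ = b ^ 2 * s ^ 2 * ∑ i ∈ Finset.range N, (A i + B (i + 1)) := by rw [Finset.mul_sum]
    _ ≤ b ^ 2 * s ^ 2 * ∑ i ∈ Finset.range (N + 1), s * ∫ x in a i..a (i + 1), g x ^ 2 :=
        mul_le_mul_of_nonneg_left ((sum_add_succ_le hA0 hB0 N).trans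
          (Finset.sum_le_sum fun i _ => hAB i)) (by positivity)
    _ = b ^ 2 * s ^ 3 * ∫ x in a 0..a (N + 1), g x ^ 2 := by
        rw [← Finset.mul_sum, intervalIntegral.sum_integral_adjacent_intervals
          fun i _ => Continuous.intervalIntegrable (by fun_prop) _ _]
        ring
    _ ≤ b ^ 2 * s ^ 3 * (4 / 3) := mul_le_mul_of_nonneg_left (hg2 _ _) (by positivity)
    _ = b ^ 2 * (4 / 3) * s ^ 3 := by ring

end Sampling

/-! ### Curves with prescribed transitions -/

theorem norm_arc_sub_le {p P : E3} (hp : ‖p‖ = 1) (hP : ‖P‖ = 1) (hpP : inner ℝ p P = 0)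
    (t : ℝ) {h : ℝ} (hh : 0 ≤ h) : ‖arc p P (t + h) - arc p P t‖ ≤ h := by
  have := norm_sub_le_integral_of_right_deriv (f := arc p P) (g := fun _ => 1) (a := t)
    (b := t + h) (by linarith) (continuous_arc p P)
    (fun x => (hasDerivAt_arc p P x).hasDerivWithinAt) continuous_const
    (fun x _ => (norm_arc hp hP hpP _).le)
  simpa using this

/-- The curve that turns from the axis `p` to the axis `p'` at the common orthogonal point `P`. -/
noncomputable def transitionCurve (T : ℝ) (p p' P : E3) (t : ℝ) : E3 :=
  arc (if 0 ≤ t then p' else p) P (profileAngle T t)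

/-- The transition cost of a profile of half-width `T`. -/
noncomputable def transitionCost (T : ℝ) : ℝ := (1 + (Real.tanh T ^ 2)⁻¹) * (4 / 3)

theorem tendsto_transitionCost : Tendsto transitionCost atTop (𝓝 (8 / 3)) := by
  have h := (((tendsto_tanh_atTop.pow 2).inv₀ (by norm_num)).const_add 1).mul_const (4 / 3 : ℝ)
  norm_num at h
  exact h

section Transition

variable {T : ℝ} {p p' P : E3} (hT : 0 < T)
include hT

theorem transitionCurve_of_ge {t : ℝ} (ht : T ≤ t) :
    transitionCurve T p p' P t = arc p' P (t - (T - profileAngle T T)) := by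
  rw [transitionCurve, if_pos (by linarith), profileAngle_of_ge hT ht]

theorem transitionCurve_of_le {t : ℝ} (ht : t ≤ -T) :
    transitionCurve T p p' P t = arc p P (t + (T - profileAngle T T)) := by
  rw [transitionCurve, if_neg (by linarith), profileAngle_of_le hT ht]

variable (hp : ‖p‖ = 1) (hp' : ‖p'‖ = 1) (hP : ‖P‖ = 1) (hpP : inner ℝ p P = 0)
  (hpP' : inner ℝ p' P = 0)
include hp hp' hP hpP hpP'

/-- The speed vanishes exactly when the axis changes, so the velocity remains continuous. Then V'' +
V has the orthogonal components σ' and 1 - σ² along the tangent and the position, σ being the speed;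
both are controlled by 1 - tanh². -/
theorem transitionCurve_regularity :
    ∃ V1 V2 : ℝ → E3, Continuous (transitionCurve T p p' P) ∧ Continuous V1 ∧
      (∀ x, HasDerivWithinAt (transitionCurve T p p' P) (V1 x) (Set.Ici x) x) ∧
      (∀ x, HasDerivWithinAt V1 (V2 x) (Set.Ici x) x) ∧ (∀ x, ‖V1 x‖ ≤ 1) ∧
      ∀ x, ‖V2 x + transitionCurve T p p' P x‖ ≤
        √(1 + (Real.tanh T ^ 2)⁻¹) * (1 - Real.tanh x ^ 2) := by
  choose w hw hwb using exists_hasDerivWithinAt_profileSpeed hT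
  set ax : ℝ → E3 := fun t => if 0 ≤ t then p' else p with hax
  have hax1 : ∀ t, ‖ax t‖ = 1 := fun t => by simp only [hax]; split_ifs <;> assumption
  have hax0 : ∀ t, inner ℝ (ax t) P = 0 := fun t => by simp only [hax]; split_ifs <;> assumption
  -- The convention `0 ≤ t` makes the axis constant to the right of every time, as right derivatives
  -- require.
  have hloc : ∀ t, ∀ᶠ y in 𝓝[≥] t, ax y = ax t := by
    intro t
    rcases lt_or_ge t 0 with h | h
    · filter_upwards [Ico_mem_nhdsGE h] with y hy
      simp only [hax]
      rw [if_neg (not_le.mpr hy.2), if_neg (not_le.mpr h)]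
    · filter_upwards [self_mem_nhdsWithin] with y hy
      simp only [hax]
      rw [if_pos (h.trans hy), if_pos h]
  set V1 : ℝ → E3 := fun t => profileSpeed T t • arc (ax t) P (profileAngle T t + Real.pi / 2)
    with hV1
  have hcΨ : Continuous (profileAngle T) :=
    continuous_iff_continuousAt.mpr fun t => (hasDerivAt_profileAngle T t).continuousAt
  refine ⟨V1, fun t => w t • arc (ax t) P (profileAngle T t + Real.pi / 2) -
    profileSpeed T t ^ 2 • arc (ax t) P (profileAngle T t), ?_, ?_, ?_, ?_, ?_, ?_⟩
  · have h1 : transitionCurve T p p' P = fun t => if 0 ≤ t then arc p' P (profileAngle T t) else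
        arc p P (profileAngle T t) := by
      ext1 t; unfold transitionCurve; split_ifs <;> rfl
    rw [h1]
    refine Continuous.if_le ((continuous_arc _ _).comp hcΨ) ((continuous_arc _ _).comp hcΨ)
      continuous_const continuous_id fun t ht => ?_
    rw [← (show (0 : ℝ) = t from ht), profileAngle_zero, arc_zero, arc_zero]
  · have h1 : V1 = fun t => if 0 ≤ t then
        profileSpeed T t • arc p' P (profileAngle T t + Real.pi / 2) else
        profileSpeed T t • arc p P (profileAngle T t + Real.pi / 2) := by
      ext1 t; simp only [hV1, hax]; split_ifs <;> rfl
    rw [h1]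
    have hc := fun p : E3 => (continuous_profileSpeed T).smul
      ((continuous_arc p P).comp (hcΨ.add_const (Real.pi / 2)))
    refine Continuous.if_le (hc p') (hc p) continuous_const continuous_id fun t ht => ?_
    rw [← (show (0 : ℝ) = t from ht), profileSpeed_zero, zero_smul, zero_smul]
  · intro x
    have h1 := (hasDerivAt_arc (ax x) P (profileAngle T x)).scomp x (hasDerivAt_profileAngle T x)
    refine h1.hasDerivWithinAt.congr_of_eventuallyEq ?_ rfl
    filter_upwards [hloc x] with y hy
    change arc (ax y) P _ = _
    rw [hy]; rfl
  · intro x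
    have h0 := (hasDerivAt_arc (ax x) P (profileAngle T x + Real.pi / 2)).scomp x
      ((hasDerivAt_profileAngle T x).add_const (Real.pi / 2))
    have h1 := (hw x).smul h0.hasDerivWithinAt
    have h2 : HasDerivWithinAt V1 _ (Set.Ici x) x := h1.congr_of_eventuallyEq (by
      filter_upwards [hloc x] with y hy
      simp only [hV1, hy]; rfl) rfl
    refine h2.congr_deriv ?_
    rw [arc_add_pi]
    simp only [Function.comp_apply]
    module
  · intro x
    simp only [hV1]
    rw [norm_smul, norm_arc (hax1 x) hP (hax0 x), mul_one,
      Real.norm_of_nonneg (profileSpeed_nonneg hT x)]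
    exact profileSpeed_le_one T x
  · intro x
    have hσ : 0 ≤ 1 - Real.tanh x ^ 2 := by linarith [tanh_sq_lt_one x]
    have h1 : w x • arc (ax x) P (profileAngle T x + Real.pi / 2) -
        profileSpeed T x ^ 2 • arc (ax x) P (profileAngle T x) + transitionCurve T p p' P x =
        w x • arc (ax x) P (profileAngle T x + Real.pi / 2) +
          (1 - profileSpeed T x ^ 2) • arc (ax x) P (profileAngle T x) := by
      change _ + arc (ax x) P (profileAngle T x) = _
      module
    beta_reduce
    rw [h1]
    refine (sq_le_sq₀ (norm_nonneg _) (by positivity)).mp ?_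
    rw [norm_arc_combination_sq (hax1 x) hP (hax0 x), mul_pow, Real.sq_sqrt (by positivity)]
    have h2 := pow_le_pow_left₀ (abs_nonneg _) (hwb x) 2
    have h3 := pow_le_pow_left₀ (abs_nonneg _) (abs_one_sub_profileSpeed_sq_le hT x) 2
    rw [sq_abs, div_pow, div_eq_mul_inv] at h2
    rw [sq_abs] at h3
    linarith

theorem norm_transitionCurve_sub_le (t : ℝ) {h : ℝ} (hh : 0 ≤ h) :
    ‖transitionCurve T p p' P (t + h) - transitionCurve T p p' P t‖ ≤ h := by
  obtain ⟨V1, V2, h1, h2, h3, h4, h5, h6⟩ :=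
    transitionCurve_regularity hT hp hp' hP hpP hpP'
  have := norm_sub_le_integral_of_right_deriv (g := fun _ => 1) (a := t)
    (b := t + h) (by linarith) h1 h3 continuous_const (fun x _ => h5 x)
  simpa using this

theorem sum_norm_curveDefect_transitionCurve_sq_le {α : ℝ} (hα : 0 < α) (hα1 : α ≤ 1) (t : ℝ)
    (N : ℕ) : ∑ i ∈ Finset.range N, ‖curveDefect α (transitionCurve T p p' P) (t + i * α)‖ ^ 2 ≤
      transitionCost T * (2 * Real.sin (α / 2)) ^ 3 := by
  obtain ⟨V1, V2, h1, h2, h3, h4, h5, h6⟩ :=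
    transitionCurve_regularity hT hp hp' hP hpP hpP'
  have h := sum_norm_curveDefect_sq_le h1 h2 h3 h4
    (continuous_const.sub (continuous_tanh.pow 2)) h6 hα hα1 integral_one_sub_tanh_sq_sq_le t N
  rwa [Real.sq_sqrt (by positivity)] at h

end Transition

/-- A curve in the union of the great circles orthogonal to the axes `p 0, …, p m` which turns from
`p (j - 1)` to `p j` near the time `τ j`. -/
structure TransitionChain (T : ℝ) (m : ℕ) (p : ℕ → E3) (τ : ℕ → ℝ) (U : ℝ → E3) : Prop where
  mem : ∀ t, ‖U t‖ = 1 ∧ ∃ j ≤ m, inner ℝ (p j) (U t) = 0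
  lipschitz : ∀ t h, 0 ≤ h → h ≤ 1 → ‖U (t + h) - U t‖ ≤ h
  energy_le : ∀ α, 0 < α → α ≤ 1 → ∀ t, ∀ N : ℕ,
    ∑ i ∈ Finset.range N, ‖curveDefect α U (t + i * α)‖ ^ 2 ≤
      m * (transitionCost T * (2 * Real.sin (α / 2)) ^ 3)
  eq_arc : ∀ j ≤ m, ∃ P, ‖P‖ = 1 ∧ inner ℝ (p j) P = 0 ∧
    ∀ t, τ j + 2 * Real.pi + T ≤ t → (j < m → t ≤ τ (j + 1) - T) → U t = arc (p j) P t

/-- Induction on the number of transitions. The new transition is timed so that its incoming arc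
coincides with the last arc of the previous curve on an overlap of length at least 2. -/
theorem exists_transitionChain {T : ℝ} (hT : 0 < T) (m : ℕ) {p : ℕ → E3} {τ : ℕ → ℝ}
    (hp : ∀ j ≤ m, ‖p j‖ = 1)
    (hτ : ∀ j < m, τ j + 2 * Real.pi + T + 2 ≤ τ (j + 1) - T) :
    ∃ U, TransitionChain T m p τ U := by
  have hπ := Real.pi_gt_three
  induction m with
  | zero =>
    obtain ⟨P, hP, hpP, -⟩ := exists_unit_orthogonal (p 0) (p 0)
    have hp0 := hp 0 le_rfl
    refine ⟨arc (p 0) P, fun t => ⟨norm_arc hp0 hP hpP t, 0, le_rfl, inner_arc hpP t⟩,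
      fun t h h0 _ => norm_arc_sub_le hp0 hP hpP t h0, fun α _ _ t N => ?_, fun j hj => ?_⟩
    · simp [curveDefect_arc]
    · obtain rfl := Nat.le_zero.mp hj
      exact ⟨P, hP, hpP, fun t _ _ => rfl⟩
  | succ m ih =>
    obtain ⟨U, hU⟩ := ih (fun j hj => hp j (by omega)) (fun j hj => hτ j (by omega))
    obtain ⟨P, hP, hpP, hUP⟩ := hU.eq_arc m le_rfl
    have hpm := hp m (by omega)
    have hpm' := hp (m + 1) le_rfl
    obtain ⟨P', hP', hpP', hpP''⟩ := exists_unit_orthogonal (p m) (p (m + 1))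
    obtain ⟨a, ha⟩ := exists_arc_eq hpm hP hpP hP' hpP'
    set c := T - profileAngle T T
    -- The old arc passes through the crossing point `P'` once per period. Delaying the transition
    -- by less than 2π matches the phases, including the lag c.
    set t0 := toIcoMod Real.two_pi_pos (τ (m + 1)) (a + c) with ht0
    have ht0mem := toIcoMod_mem_Ico Real.two_pi_pos (τ (m + 1)) (a + c)
    rw [← ht0] at ht0mem
    have hspace := hτ m (by omega)
    set V : ℝ → E3 := fun t => transitionCurve T (p m) (p (m + 1)) P' (t - t0) with hV
    have hVU : ∀ t, τ m + 2 * Real.pi + T ≤ t → t ≤ τ (m + 1) - T → V t = U t := by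
      intro t h1 h2
      simp only [hV]
      rw [transitionCurve_of_le hT (by linarith [ht0mem.1]), hUP t h1 (fun h => absurd h (by simp)),
        ha, arc_arc hpm hpP]
      have h3 : t0 = a + c - toIcoDiv Real.two_pi_pos (τ (m + 1)) (a + c) * (2 * Real.pi) := by
        rw [ht0, ← self_sub_toIcoDiv_zsmul, zsmul_eq_mul]
      rw [← arc_periodic (p m) P t (-toIcoDiv Real.two_pi_pos (τ (m + 1)) (a + c))]
      congr 1
      push_cast
      rw [h3]; ring
    set W : ℝ → E3 := fun t => if t ≤ τ (m + 1) - T then U t else V t with hW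
    have hWU : ∀ t, t ≤ τ (m + 1) - T → W t = U t := fun t ht => if_pos ht
    have hWV : ∀ t, τ m + 2 * Real.pi + T ≤ t → W t = V t := by
      intro t ht
      by_cases h : t ≤ τ (m + 1) - T
      · rw [hWU t h, hVU t ht h]
      · exact if_neg h
    have hVmem : ∀ t, ‖V t‖ = 1 ∧ ∃ j ≤ m + 1, inner ℝ (p j) (V t) = 0 := by
      intro t
      simp only [hV, transitionCurve]
      split_ifs
      · exact ⟨norm_arc hpm' hP' hpP'' _, m + 1, le_rfl, inner_arc hpP'' _⟩
      · exact ⟨norm_arc hpm hP' hpP' _, m, by omega, inner_arc hpP' _⟩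
    refine ⟨W, fun t => ?_, fun t h h0 h1 => ?_, fun α hα hα1 t N => ?_, fun j hj => ?_⟩
    · rcases le_or_gt t (τ (m + 1) - T) with h | h
      · rw [hWU t h]
        obtain ⟨h1, j, hj, h2⟩ := hU.mem t
        exact ⟨h1, j, by omega, h2⟩
      · rw [hWV t (by linarith)]
        exact hVmem t
    · rcases le_or_gt (t + h) (τ (m + 1) - T) with h' | h'
      · rw [hWU _ h', hWU t (by linarith)]
        exact hU.lipschitz t h h0 h1
      · rw [hWV _ (by linarith), hWV t (by linarith)]
        simp only [hV]
        rw [add_sub_right_comm]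
        exact norm_transitionCurve_sub_le hT hpm hpm' hP' hpP' hpP'' _ h0
    · have hVdef : ∀ x, curveDefect α V x =
          curveDefect α (transitionCurve T (p m) (p (m + 1)) P') (x - t0) := by
        intro x
        simp only [curveDefect, hV]
        rw [add_sub_right_comm, add_sub_right_comm]
      have hterm : ∀ x, ‖curveDefect α W x‖ ^ 2 ≤
          ‖curveDefect α U x‖ ^ 2 + ‖curveDefect α V x‖ ^ 2 := by
        intro x
        -- As α ≤ 1, a three-point stencil has length at most 2, hence sees only `U` or only `V`:
        -- splicing creates no extra energy.
        rcases le_or_gt (x + 2 * α) (τ (m + 1) - T) with h | h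
        · have : curveDefect α W x = curveDefect α U x := by
            simp only [curveDefect]
            rw [hWU _ h, hWU (x + α) (by linarith), hWU x (by linarith)]
          rw [this]
          exact le_add_of_nonneg_right (by positivity)
        · have : curveDefect α W x = curveDefect α V x := by
            simp only [curveDefect]
            rw [hWV (x + 2 * α) (by linarith), hWV (x + α) (by linarith), hWV x (by linarith)]
          rw [this]
          exact le_add_of_nonneg_left (by positivity)
      refine (Finset.sum_le_sum fun (i : ℕ) _ => hterm (t + i * α)).trans ?_
      rw [Finset.sum_add_distrib]
      have e1 := hU.energy_le α hα hα1 t N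
      have e2 := sum_norm_curveDefect_transitionCurve_sq_le hT hpm hpm' hP' hpP' hpP'' hα hα1
        (t - t0) N
      have e3 : ∑ i ∈ Finset.range N, ‖curveDefect α V (t + i * α)‖ ^ 2 = ∑ i ∈ Finset.range N,
          ‖curveDefect α (transitionCurve T (p m) (p (m + 1)) P') (t - t0 + i * α)‖ ^ 2 :=
        Finset.sum_congr rfl fun i _ => by rw [hVdef, add_sub_right_comm]
      rw [e3]
      push_cast
      linarith
    · rcases Nat.lt_or_ge j (m + 1) with hjm | hjm
      · obtain ⟨P0, h1, h2, h3⟩ := hU.eq_arc j (by omega)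
        refine ⟨P0, h1, h2, fun t ht htj => ?_⟩
        have htj := htj hjm
        have hmono : ∀ i, j + 1 ≤ i → i ≤ m + 1 → τ (j + 1) ≤ τ i := by
          intro i hi
          induction i, hi using Nat.le_induction with
          | base => exact fun _ => le_rfl
          | succ i hi ih' => intro him; linarith [ih' (by omega), hτ i (by omega)]
        rw [hWU t (by linarith [hmono (m + 1) (by omega) le_rfl])]
        exact h3 t ht fun _ => htj
      · obtain rfl : j = m + 1 := by omega
        refine ⟨arc (p (m + 1)) P' (-t0 - c), norm_arc hpm' hP' hpP'' _, inner_arc hpP'' _,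
          fun t ht _ => ?_⟩
        rw [hWV t (by linarith), arc_arc hpm' hpP'']
        simp only [hV]
        rw [transitionCurve_of_ge hT (by linarith [ht0mem.2])]
        congr 1; ring

/-! ### The recovery sequence -/

theorem inner_arc_arc {p P : E3} (hp : ‖p‖ = 1) (hP : ‖P‖ = 1) (hpP : inner ℝ p P = 0)
    (a b : ℝ) : inner ℝ (arc p P a) (arc p P b) = Real.cos (a - b) := by
  have hc : inner ℝ (cross p P) P = 0 := by rw [real_inner_comm, inner_cross_right_self]
  rw [arc, arc, inner_add_left, inner_add_right, inner_add_right]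
  simp only [inner_smul_left, inner_smul_right, real_inner_self_eq_norm_sq, hc,
    inner_cross_right_self, norm_cross_eq_one hp hP hpP, hP, Real.cos_sub]
  simp only [conj_trivial]
  ring

/-- The angle between neighbouring spins of the ground states. -/
noncomputable def bondAngle (delta : ℝ) : ℝ := 2 * Real.arcsin (stepScale delta / 2)

theorem bondAngle_pos {delta : ℝ} (h0 : 0 < stepScale delta) : 0 < bondAngle delta := by
  have := Real.arcsin_pos.mpr (half_pos h0)
  unfold bondAngle
  positivity

section BondAngle

variable {delta : ℝ} (h0 : 0 < stepScale delta) (h1 : stepScale delta ≤ 1)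
include h0 h1

theorem two_mul_sin_half_bondAngle : 2 * Real.sin (bondAngle delta / 2) = stepScale delta := by
  rw [bondAngle, mul_div_cancel_left₀ _ two_ne_zero, Real.sin_arcsin (by linarith) (by linarith)]
  ring

theorem stepScale_le_bondAngle : stepScale delta ≤ bondAngle delta := by
  have h := Real.sin_le (x := bondAngle delta / 2) (by linarith [bondAngle_pos h0])
  have := two_mul_sin_half_bondAngle h0 h1
  linarith

theorem bondAngle_le : bondAngle delta ≤ 2 * stepScale delta := by
  have hpos := bondAngle_pos h0
  have hle : bondAngle delta / 2 ≤ Real.pi / 2 := by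
    rw [bondAngle, mul_div_cancel_left₀ _ two_ne_zero]; exact Real.arcsin_le_pi_div_two _
  have h := Real.mul_le_sin (x := bondAngle delta / 2) (by linarith) hle
  have h2 := two_mul_sin_half_bondAngle h0 h1
  have hπ := Real.pi_le_four
  have hπ0 := Real.pi_pos
  have h3 : 2 / Real.pi * (bondAngle delta / 2) = bondAngle delta / Real.pi := by field_simp
  rw [h3, div_le_iff₀ hπ0] at h
  nlinarith

/-- With this angle the second difference of the sampled curve is exactly the defect of the chain,
and uniform rotations are ground states. -/
theorem two_mul_cos_bondAngle : 2 * Real.cos (bondAngle delta) = 2 - stepScale delta ^ 2 := by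
  have h2 := two_mul_sin_half_bondAngle h0 h1
  have h3 := Real.cos_two_mul (bondAngle delta / 2)
  have h4 := Real.cos_sq' (bondAngle delta / 2)
  rw [mul_div_cancel₀ _ two_ne_zero] at h3
  rw [h3, h4, ← h2]; ring

/-- The length of the chirality on a ground state: slightly below 1, and tending to 1 with δ. -/
theorem inv_mul_sin_bondAngle :
    (stepScale delta)⁻¹ * Real.sin (bondAngle delta) = Real.cos (bondAngle delta / 2) := by
  have h2 := two_mul_sin_half_bondAngle h0 h1
  have h3 := Real.sin_two_mul (bondAngle delta / 2)
  rw [mul_div_cancel₀ _ two_ne_zero, h2] at h3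
  rw [h3, inv_mul_cancel_left₀ h0.ne']

end BondAngle

theorem memLp_chiralityFun (lam delta : ℝ) (u : ℕ → E3) :
    MemLp (chiralityFun lam delta u) 1 volI := by
  have : IsFiniteMeasure volI := by unfold volI; infer_instance
  have hm : Measurable (chiralityFun lam delta u) :=
    (measurable_from_nat (f := chirality lam delta u)).comp
      (Nat.measurable_floor.comp (measurable_id.div_const lam))
  refine MemLp.of_bound hm.aestronglyMeasurable
    (∑ i ∈ Finset.range (lastIdx lam + 1), ‖chirality lam delta u i‖) (Eventually.of_forall ?_)
  intro x
  have h : chiralityFun lam delta u x =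
      chirality lam delta u (min ⌊x / lam⌋₊ (lastIdx lam - 1)) := by
    simp [chiralityFun, chirality]
  rw [h]
  exact Finset.single_le_sum (f := fun i => ‖chirality lam delta u i‖) (fun _ _ => norm_nonneg _)
    (Finset.mem_range.mpr (by omega))

/-- A configuration with `m` transitions at distance `T` from the prescribed positions. -/
theorem exists_config {k : ℕ} {q : Fin k → E3} (hq : ∀ l, ‖q l‖ = 1) {lam delta T : ℝ}
    (hlam : 0 < lam) (hlam2 : lam < 1 / 2) (hs : 0 < stepScale delta)
    (hα1 : bondAngle delta ≤ 1) (hs1 : stepScale delta ≤ 1) (hT : 0 < T) {m : ℕ} {x : ℕ → ℝ}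
    {p : ℕ → E3} (hx0 : x 0 = 0) (hx1 : x (m + 1) = 1) (hp : ∀ j ≤ m, p j ∈ wells q)
    (hspace : ∀ j ≤ m, 2 * Real.pi + 2 + 2 * T ≤ (x (j + 1) - x j) * (bondAngle delta / lam)) :
    ∃ u ∈ Configs lam (circles q),
      ∑ i ∈ Finset.range (lastIdx lam - 1), ‖defect (stepScale delta) u i‖ ^ 2 ≤
        m * (transitionCost T * stepScale delta ^ 3) ∧
      (∀ y, ‖chiralityFun lam delta u y‖ ≤ 2) ∧
      ∀ j ≤ m, ∀ y, 0 ≤ y → ⌊y / lam⌋₊ + 1 ≤ lastIdx lam →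
        2 * Real.pi + 2 + 2 * T ≤ (y - x j) * (bondAngle delta / lam) →
        2 * Real.pi + 2 + 2 * T ≤ (x (j + 1) - y) * (bondAngle delta / lam) →
        chiralityFun lam delta u y = Real.cos (bondAngle delta / 2) • p j := by
  have hπ := Real.pi_gt_three
  set α := bondAngle delta with hα
  set s := stepScale delta with hsdef
  set L := α / lam with hL
  have hα0 : 0 < α := bondAngle_pos hs
  have hL0 : 0 < L := div_pos hα0 hlam
  have hpn : ∀ j ≤ m, ‖p j‖ = 1 := fun j hj => norm_eq_one_of_mem_wells hq (hp j hj)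
  -- The fictitious time τ 0 is chosen so that the first arc of uniform rotation is already under
  -- way at time 0.
  set τ : ℕ → ℝ := fun j => if j = 0 then -(2 * Real.pi + T) else x j * L with hτdef
  have hτ0 : τ 0 = -(2 * Real.pi + T) := if_pos rfl
  have hτs : ∀ j, τ (j + 1) = x (j + 1) * L := fun j => if_neg (Nat.succ_ne_zero j)
  have hτle : ∀ j, τ j + 2 * Real.pi + T ≤ x j * L + 2 * Real.pi + T := by
    intro j
    cases j with
    | zero => rw [hτ0, hx0]; linarith
    | succ j => rw [hτs]
  have hτ : ∀ j < m, τ j + 2 * Real.pi + T + 2 ≤ τ (j + 1) - T := by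
    intro j hj
    have h1 := hspace j hj.le
    have h2 := hτle j
    rw [hτs]
    linarith
  obtain ⟨U, hU⟩ := exists_transitionChain hT m hpn hτ
  have hsin := two_mul_sin_half_bondAngle hs hs1
  have hlast : 1 / lam - 1 < lastIdx lam := by
    have := Nat.lt_floor_add_one (1 / lam)
    unfold lastIdx
    linarith
  have h2lam : 2 < 1 / lam := by rw [lt_div_iff₀ hlam]; linarith
  have hN2 : 2 ≤ lastIdx lam := Nat.le_floor (by exact_mod_cast h2lam.le)
  obtain ⟨n, hn⟩ : ∃ n, lastIdx lam = n + 1 := ⟨lastIdx lam - 1, by omega⟩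
  refine ⟨fun i => U (i * α), ⟨fun i _ => ?_, ?_⟩, ?_, ?_, ?_⟩
  · obtain ⟨h1, j, hj, h2⟩ := hU.mem (i * α)
    obtain ⟨l, hl | hl⟩ := hp j hj
    · exact Set.mem_iUnion.mpr ⟨l, h1, hl ▸ h2⟩
    · refine Set.mem_iUnion.mpr ⟨l, h1, ?_⟩
      rwa [hl, inner_neg_left, neg_eq_zero] at h2
  -- The boundary condition holds because the first and the last bond both lie on arcs of uniform
  -- rotation, so both scalar products equal cos α.
  · obtain ⟨P, hP, hpP, hUP⟩ := hU.eq_arc 0 (Nat.zero_le _)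
    obtain ⟨P', hP', hpP', hUP'⟩ := hU.eq_arc m le_rfl
    have e0 : U ((0 : ℕ) * α) = arc (p 0) P 0 := by
      rw [Nat.cast_zero, zero_mul]
      refine hUP 0 (by rw [hτ0]; linarith) fun hm => ?_
      have := hτ 0 hm
      rw [hτ0] at this
      linarith
    have e1 : U ((1 : ℕ) * α) = arc (p 0) P α := by
      rw [Nat.cast_one, one_mul]
      refine hUP α (by rw [hτ0]; linarith) fun hm => ?_
      have := hτ 0 hm
      rw [hτ0] at this
      linarith
    -- The last bond starts at most two steps before the end; the summand 2 in the spacing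
    -- hypothesis pays for them since α ≤ 1.
    have hend : τ m + 2 * Real.pi + T ≤ n * α := by
      have h1 := hspace m le_rfl
      rw [hx1] at h1
      have h2 := hτle m
      have h3 : (1 / lam - 2) * α ≤ n * α := by
        refine mul_le_mul_of_nonneg_right ?_ hα0.le
        rw [hn] at hlast
        push_cast at hlast
        linarith
      have h4 : (1 / lam - 2) * α = L - 2 * α := by rw [hL]; ring
      linarith
    have e2 : U ((n : ℕ) * α) = arc (p m) P' (n * α) :=
      hUP' _ hend fun h => absurd h (lt_irrefl _)
    have e3 : U ((n + 1 : ℕ) * α) = arc (p m) P' ((n + 1 : ℕ) * α) :=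
      hUP' _ (hend.trans (by push_cast; linarith)) fun h => absurd h (lt_irrefl _)
    beta_reduce
    rw [hn, Nat.add_sub_cancel, e0, e1, e2, e3, inner_arc_arc (hpn 0 (Nat.zero_le _)) hP hpP,
      inner_arc_arc (hpn m le_rfl) hP' hpP']
    congr 1
    push_cast
    ring
  · have h1 := hU.energy_le α hα0 hα1 0 (lastIdx lam - 1)
    rw [hsin] at h1
    refine (Finset.sum_congr rfl fun i _ => ?_).trans_le h1
    rw [defect, curveDefect, two_mul_cos_bondAngle hs hs1]
    push_cast
    rw [show ((i : ℝ) + 2) * α = 0 + i * α + 2 * α by ring,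
      show ((i : ℝ) + 1) * α = 0 + i * α + α by ring, zero_add]
  · intro y
    rw [chiralityFun, chirality]
    set i := min ⌊y / lam⌋₊ (lastIdx lam - 1)
    have h1 : cross (U (i * α)) (U ((i + 1 : ℕ) * α)) =
        cross (U (i * α)) (U (i * α + α) - U (i * α)) := by
      rw [cross_sub_right, cross_self', sub_zero]
      push_cast
      rw [add_mul, one_mul]
    have h2 := norm_cross_le (U (i * α)) (U (i * α + α) - U (i * α))
    rw [(hU.mem _).1, one_mul] at h2
    have h3 := h2.trans (hU.lipschitz (i * α) α hα0.le hα1)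
    rw [h1, norm_smul, norm_inv, Real.norm_of_nonneg (Real.sqrt_nonneg _)]
    change s⁻¹ * _ ≤ 2
    rw [inv_mul_le_iff₀ hs]
    linarith [bondAngle_le hs hs1]
  · intro j hj y hy hyN h1 h2
    obtain ⟨P, hP, hpP, hUP⟩ := hU.eq_arc j hj
    rw [chiralityFun, chirality_eq_bondChirality hyN, bondChirality]
    set i := ⌊y / lam⌋₊
    have hi1 : (i : ℝ) * α ≤ y * L := by
      have := mul_le_mul_of_nonneg_right (Nat.floor_le (div_nonneg hy hlam.le)) hα0.le
      rw [hL]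
      calc _ ≤ _ := this
        _ = _ := by ring
    have hi2 : y * L ≤ i * α + α := by
      have := mul_le_mul_of_nonneg_right (Nat.lt_floor_add_one (y / lam)).le hα0.le
      rw [hL]
      calc y * (α / lam) = y / lam * α := by ring
        _ ≤ _ := this
        _ = _ := by ring
    have hlo : τ j + 2 * Real.pi + T ≤ i * α := by
      have := hτle j
      linarith
    have hhi : j < m → i * α + α ≤ τ (j + 1) - T := by
      intro _
      rw [hτs]
      linarith
    rw [Nat.cast_add, Nat.cast_one, add_mul, one_mul,
      hUP _ hlo fun h => (le_add_of_nonneg_right hα0.le).trans (hhi h),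
      hUP _ (hlo.trans (le_add_of_nonneg_right hα0.le)) hhi, cross_arc_arc hP hpP,
      add_sub_cancel_left, smul_smul, inv_mul_sin_bondAngle hs hs1]

theorem exists_mem_Ioo_of_partition {m : ℕ} {x : ℕ → ℝ} {y : ℝ} (h0 : x 0 < y)
    (hne : ∀ j, y ≠ x j) (hm : y < x (m + 1)) : ∃ j ≤ m, y ∈ Set.Ioo (x j) (x (j + 1)) := by
  induction m with
  | zero => exact ⟨0, le_rfl, h0, hm⟩
  | succ m ih =>
    rcases lt_or_gt_of_ne (hne (m + 1)) with h | h
    · obtain ⟨j, hj, hy⟩ := ih h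
      exact ⟨j, by omega, hy⟩
    · exact ⟨m + 1, le_rfl, h, hm⟩

theorem tendsto_toLp_of_bounded {f : ℕ → ℝ → E3} (hf : ∀ n, MemLp (f n) 1 volI) {z : L1I} {C : ℝ}
    (hfC : ∀ᶠ n in atTop, ∀ y, ‖f n y‖ ≤ C) (hz : ∀ᵐ y ∂volI, ‖z y‖ ≤ C)
    (hlim : ∀ᵐ y ∂volI, Tendsto (fun n => f n y) atTop (𝓝 (z y))) :
    Tendsto (fun n => (hf n).toLp (f n)) atTop (𝓝 z) := by
  have : IsFiniteMeasure volI := by unfold volI; infer_instance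
  rw [Lp.tendsto_Lp_iff_tendsto_eLpNorm']
  have heq : ∀ n, eLpNorm (⇑((hf n).toLp (f n)) - ⇑z) 1 volI = ∫⁻ y, ‖f n y - z y‖ₑ ∂volI := by
    intro n
    rw [eLpNorm_one_eq_lintegral_enorm]
    refine lintegral_congr_ae ?_
    filter_upwards [(hf n).coeFn_toLp] with y hy
    rw [Pi.sub_apply, hy]
  simp only [heq]
  have h := tendsto_lintegral_filter_of_dominated_convergence' (μ := volI) (l := atTop)
    (F := fun n y => ‖f n y - z y‖ₑ) (f := fun _ => 0) (fun _ => ENNReal.ofReal (C + C)) ?_ ?_ ?_ ?_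
  · simpa using h
  · exact Eventually.of_forall fun n =>
      ((hf n).aestronglyMeasurable.sub (Lp.aestronglyMeasurable z)).enorm
  · filter_upwards [hfC] with n hn
    filter_upwards [hz] with y hy
    rw [← ofReal_norm]
    exact ENNReal.ofReal_le_ofReal ((norm_sub_le _ _).trans (add_le_add (hn y) hy))
  · rw [lintegral_const]
    exact ENNReal.mul_ne_top ENNReal.ofReal_ne_top (measure_ne_top _ _)
  · filter_upwards [hlim] with y hy
    have := (hy.sub_const (z y)).enorm
    rwa [sub_self, enorm_zero] at this

theorem eventually_add_two_mul_sqrt_le {L : ℕ → ℝ} (hL : Tendsto L atTop atTop) (c : ℝ) {d : ℝ}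
    (hd : 0 < d) : ∀ᶠ n in atTop, c + 2 * √(L n) ≤ d * L n := by
  have hT : Tendsto (fun n => √(L n)) atTop atTop := Real.tendsto_sqrt_atTop.comp hL
  filter_upwards [hT.eventually_ge_atTop ((2 + |c|) / d), hT.eventually_ge_atTop 1,
    hL.eventually_ge_atTop 0] with n h1 h2 h3
  rw [div_le_iff₀ hd] at h1
  have h4 : √(L n) * √(L n) = L n := Real.mul_self_sqrt h3
  have h5 := le_abs_self c
  have h6 := abs_nonneg c
  calc c + 2 * √(L n) ≤ (2 + |c|) * √(L n) := by nlinarith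
    _ ≤ (√(L n) * d) * √(L n) := mul_le_mul_of_nonneg_right h1 (by linarith)
    _ = d * L n := by linear_combination d * h4

/-- The half-width T = √L, with L = α/λ → ∞, tends to infinity, so the cost tends to 8/3, yet is
o(L), so transitions fit between the jumps and, after rescaling, every point off the partition
eventually lies on a plateau. -/
theorem exists_recovery {k : ℕ} {q : Fin k → E3} (hq : ∀ l, ‖q l‖ = 1)
    {lam delta : ℕ → ℝ} (hlam : ∀ n, 0 < lam n) (hdelta : ∀ n, 0 < delta n)
    (hlam_lim : Tendsto lam atTop (𝓝 0))
    (hscale : Tendsto (fun n => stepScale (delta n)) atTop (𝓝 0))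
    (hratio : Tendsto (fun n => lam n / stepScale (delta n)) atTop (𝓝 0)) (z : L1I) :
    ∃ zs : ℕ → L1I, Tendsto zs atTop (𝓝 z) ∧
      limsup (fun n => chiralEnergy (lam n) (delta n) (circles q) (zs n) /
        ENNReal.ofReal (√2 * lam n * delta n ^ (3 / 2 : ℝ))) atTop ≤ limitEnergy (wells q) z := by
  have htriv : limitEnergy (wells q) z = ∞ → ∃ zs : ℕ → L1I, Tendsto zs atTop (𝓝 z) ∧
      limsup (fun n => chiralEnergy (lam n) (delta n) (circles q) (zs n) /
        ENNReal.ofReal (√2 * lam n * delta n ^ (3 / 2 : ℝ))) atTop ≤ limitEnergy (wells q) z :=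
    fun h => ⟨fun _ => z, tendsto_const_nhds, h ▸ le_top⟩
  by_cases hz : z ∈ BVI (wells q)
  swap
  · exact htriv (by rw [limitEnergy, if_neg hz])
  by_cases hS : (jumpSet z).Finite
  swap
  · refine htriv ?_
    rw [limitEnergy, if_pos hz, Set.not_finite.mp hS |>.encard_eq]
    simp
  obtain ⟨x, p, hx0, hx1, hxlt, hp, hzp⟩ := exists_piecewise_const (L1.integrable_coeFn z)
    (finite_wells q) hz.2 hS
  have hlimit : limitEnergy (wells q) z = ENNReal.ofReal ((jumpSet z).ncard * (8 / 3)) := by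
    rw [limitEnergy, if_pos hz, hS.encard_eq_coe_toFinset_card, mul_comm _ (8 / 3 : ℝ),
      ENNReal.ofReal_mul (by norm_num), Set.ncard_eq_toFinset_card _ hS, ENNReal.ofReal_natCast]
    rfl
  set m := (jumpSet z).ncard
  have hspos : ∀ n, 0 < stepScale (delta n) := fun n =>
    Real.sqrt_pos.mpr (mul_pos two_pos (hdelta n))
  set L : ℕ → ℝ := fun n => bondAngle (delta n) / lam n with hLdef
  have hs1 : ∀ᶠ n in atTop, stepScale (delta n) ≤ 1 / 2 :=
    (hscale.eventually (gt_mem_nhds (by norm_num : (0 : ℝ) < 1 / 2))).mono fun _ h => h.le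
  have hα : Tendsto (fun n => bondAngle (delta n)) atTop (𝓝 0) := by
    have h2 := hscale.const_mul 2
    rw [mul_zero] at h2
    refine tendsto_of_tendsto_of_tendsto_of_le_of_le' tendsto_const_nhds h2 ?_ ?_
    · exact Eventually.of_forall fun n => (bondAngle_pos (hspos n)).le
    · filter_upwards [hs1] with n hn using bondAngle_le (hspos n) (by linarith)
  have hL : Tendsto L atTop atTop := by
    have h1 : Tendsto (fun n => (lam n / stepScale (delta n))⁻¹) atTop atTop :=
      Tendsto.inv_tendsto_nhdsGT_zero (tendsto_nhdsWithin_iff.mpr ⟨hratio,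
        Eventually.of_forall fun n => div_pos (hlam n) (hspos n)⟩)
    refine tendsto_atTop_mono' _ ?_ h1
    filter_upwards [hs1] with n hn
    rw [inv_div]
    exact div_le_div_of_nonneg_right (stepScale_le_bondAngle (hspos n) (by linarith)) (hlam n).le
  have hT : Tendsto (fun n => √(L n)) atTop atTop := Real.tendsto_sqrt_atTop.comp hL
  have hspace : ∀ᶠ n in atTop, ∀ j ∈ Finset.range (m + 1),
      2 * Real.pi + 2 + 2 * √(L n) ≤ (x (j + 1) - x j) * L n := by
    rw [Filter.eventually_all_finset]
    intro j hj
    exact eventually_add_two_mul_sqrt_le hL _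
      (sub_pos.mpr (hxlt j (Nat.lt_succ_iff.mp (Finset.mem_range.mp hj))))
  have hgood : ∀ᶠ n in atTop, ∃ u ∈ Configs (lam n) (circles q),
      ∑ i ∈ Finset.range (lastIdx (lam n) - 1), ‖defect (stepScale (delta n)) u i‖ ^ 2 ≤
        m * (transitionCost (√(L n)) * stepScale (delta n) ^ 3) ∧
      (∀ y, ‖chiralityFun (lam n) (delta n) u y‖ ≤ 2) ∧
      ∀ j ≤ m, ∀ y, 0 ≤ y → ⌊y / lam n⌋₊ + 1 ≤ lastIdx (lam n) →
        2 * Real.pi + 2 + 2 * √(L n) ≤ (y - x j) * L n →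
        2 * Real.pi + 2 + 2 * √(L n) ≤ (x (j + 1) - y) * L n →
        chiralityFun (lam n) (delta n) u y = Real.cos (bondAngle (delta n) / 2) • p j := by
    filter_upwards [hs1, hT.eventually_gt_atTop 0, hspace,
      hlam_lim.eventually (gt_mem_nhds (by norm_num : (0 : ℝ) < 1 / 2))] with n h1 h2 h3 h4
    exact exists_config hq (hlam n) h4 (hspos n)
      ((bondAngle_le (hspos n) (by linarith)).trans (by linarith)) (by linarith) h2 hx0 hx1 hp
      fun j hj => h3 j (Finset.mem_range.mpr (by omega))
  -- The configurations exist only for large n; the finitely many other indices affect neither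
  -- limit.
  obtain ⟨u, hu⟩ := hgood.choice
  refine ⟨fun n => (memLp_chiralityFun (lam n) (delta n) (u n)).toLp _, ?_, ?_⟩
  · refine tendsto_toLp_of_bounded (C := 2) _ (hu.mono fun n hn => hn.2.2.1) ?_ ?_
    · filter_upwards [hz.2] with y hy
      rw [norm_eq_one_of_mem_wells hq hy]
      norm_num
    · have hne : ∀ᵐ y : ℝ, ∀ j, y ≠ x j :=
        ae_all_iff.mpr fun j => by simp [ae_iff, measure_singleton]
      have hzp' : ∀ᵐ y : ℝ, ∀ j, j ≤ m → y ∈ Set.Ioo (x j) (x (j + 1)) → z y = p j := by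
        refine ae_all_iff.mpr fun j => ?_
        by_cases hj : j ≤ m
        · filter_upwards [hzp j hj] with y hy _ using hy
        · exact Eventually.of_forall fun y h => absurd h hj
      filter_upwards [ae_restrict_of_ae hne, ae_restrict_of_ae hzp',
        ae_restrict_mem measurableSet_Ioo] with y hy1 hy2 hy
      obtain ⟨j, hj, hyj⟩ := exists_mem_Ioo_of_partition (hx0 ▸ hy.1) hy1 (hx1 ▸ hy.2)
      rw [hy2 j hj hyj]
      have hlim : Tendsto (fun n => Real.cos (bondAngle (delta n) / 2) • p j) atTop (𝓝 (p j)) := by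
        have := ((Real.continuous_cos.tendsto _).comp (hα.div_const 2)).smul_const (p j)
        simpa using this
      refine hlim.congr' ?_
      filter_upwards [hu, eventually_floor_add_le hlam hlam_lim hy.1.le hy.2 1,
        eventually_add_two_mul_sqrt_le hL (2 * Real.pi + 2) (sub_pos.mpr hyj.1),
        eventually_add_two_mul_sqrt_le hL (2 * Real.pi + 2) (sub_pos.mpr hyj.2)] with n h1 h2 h3 h4
      exact (h1.2.2.2 j hj y hy.1.le h2 h3 h4).symm
  · have hcost : Tendsto (fun n => ENNReal.ofReal (m * transitionCost (√(L n)))) atTop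
        (𝓝 (limitEnergy (wells q) z)) := by
      rw [hlimit]
      exact ENNReal.tendsto_ofReal ((tendsto_transitionCost.comp hT).const_mul _)
    rw [← hcost.limsup_eq]
    refine limsup_le_limsup ?_
    filter_upwards [hu] with n hn
    have hD : 0 < √2 * lam n * delta n ^ (3 / 2 : ℝ) := by
      have := hlam n; have := hdelta n; positivity
    have h1 : chiralEnergy (lam n) (delta n) (circles q)
        ((memLp_chiralityFun (lam n) (delta n) (u n)).toLp _) ≤
        ENNReal.ofReal (energy (lam n) (delta n) (u n)) :=
      iInf₂_le (u n) ⟨hn.1, MemLp.coeFn_toLp _⟩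
    refine (ENNReal.div_le_div_right h1 _).trans ?_
    rw [← ENNReal.ofReal_div_of_pos hD]
    refine ENNReal.ofReal_le_ofReal ?_
    rw [div_le_iff₀ hD, energy_eq (hdelta n).le, scaling_eq (hdelta n).le]
    have h2 := mul_le_mul_of_nonneg_left hn.2.1 (half_pos (hlam n)).le
    linarith

end HelicalChain

theorem theorem3p11 (k : ℕ) (hk : 1 ≤ k) (q : Fin k → HelicalChain.E3)
    (hq : ∀ l, ‖q l‖ = 1) (hq_inj : Function.Injective q)
    (lam delta : ℕ → ℝ) (hlam : ∀ n, 0 < lam n) (hdelta : ∀ n, 0 < delta n)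
    (hlam_lim : Tendsto lam atTop (𝓝 0)) (hdelta_lim : Tendsto delta atTop (𝓝 0))
    (hratio : Tendsto (fun n => lam n / Real.sqrt (delta n)) atTop (𝓝 0)) :
    HelicalChain.GammaConverges
      (fun n z => HelicalChain.chiralEnergy (lam n) (delta n) (HelicalChain.circles q) z /
        ENNReal.ofReal (Real.sqrt 2 * lam n * delta n ^ (3 / 2 : ℝ)))
      (HelicalChain.limitEnergy (HelicalChain.wells q)) := by
  have hscale : Tendsto (fun n => HelicalChain.stepScale (delta n)) atTop (𝓝 0) := by
    have := (hdelta_lim.const_mul 2).sqrt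
    rwa [mul_zero, Real.sqrt_zero] at this
  have hratio' : Tendsto (fun n => lam n / HelicalChain.stepScale (delta n)) atTop (𝓝 0) := by
    have := hratio.div_const √2
    rw [zero_div] at this
    refine this.congr fun n => ?_
    rw [HelicalChain.stepScale, Real.sqrt_mul zero_le_two, div_div, mul_comm]
  exact ⟨fun z zs hzs => HelicalChain.limitEnergy_le_liminf hq hlam hdelta hlam_lim hscale hratio'
    hzs, fun z => HelicalChain.exists_recovery hq hlam hdelta hlam_lim hscale hratio' z⟩
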